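/- **Setting.** Let $k\ge 1$, let $(V,E)$ be a finite $k$-uniform hypergraph ($E$ is a family of $k$-element subsets of $V$), $n=|V|$. The weights $\tilde c_e\in\mathbb Z_+$ ($e\in E$) are independent random variables with unknown distributions; we are given integers $0\le c_e^-\le c_e^+$ and $p\in(0,1]$ such that $c_e^-\le\tilde c_e\le c_e^+$ and $\Pr(\tilde c_e=c_e^+)\ge p$. Put $\Delta_c=\max_e(c_e^+-c_e^-)$. The realized weight $c_e$ is revealed by querying $e$. For an objective vector $c$, the matching LP is $\max\{\sum_e c_ex_e : x\ge 0,\ \sum_{e\ni u}x_e\le 1\ (u\in V)\}$, and its dual is $\min\{\sum_u y_u : y\ge 0,\ \sum_{u\in e}y_u\ge c_e\ (e\in E)\}$. The optimistic (pessimistic) LP has as objective the realized weights of the queried edges and $c_e^+$ (respectively $c_e^-$) for the other edges. A matching is a set of pairwise disjoint edges; it is $\rho$-approximate if its realized weight is at least $\rho$ times the maximum realized weight of a matching. Put $\alpha=1/(k-1+1/k)$. **Adaptive strategy (Algorithm 1) with $T$ iterations.** In each iteration compute an optimal solution $x$ of the current optimistic LP and query every edge $e$ independently with probability $x_e$. After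 $T$ iterations apply an LP-relative $\alpha$-approximation to the pessimistic LP, that is, a rule which returns a matching of weight at least $\alpha$ times the optimal LP value, and output this matching. **Theorem.** (1) There is a universal constant $C>0$ such that, for every instance as above and every $\varepsilon\in(0,1)$, optimal LP solutions and an LP-relative $\alpha$-approximation exist, and for every integer $$T\ \ge\ C\,\frac{\Delta_c\,\bigl(k\log(n/\varepsilon)+1/\varepsilon\bigr)}{\varepsilon p}$$ the adaptive strategy, with any choice of the optimal LP solutions and of the LP-relative $\alpha$-approximation, outputs a $\frac{1-\varepsilon}{k-1+1/k}$-approximate matching with probability at least $1-\varepsilon$. (2) For every $c\in\mathbb Z_+^E$ and every real $\mu$ larger than the optimal LP value for $c$, the dual has an optimal solution $y$ with $|\mathrm{supp}(y)|<k\mu$. Moreover, for all $\varepsilon\in(0,1)$ and $\mu\ge1$, the set $W$ of all $y\in\bigl(\tfrac{\varepsilon}{2k}\mathbb Z_+\bigr)^V$ with $\sum_u y_u\le(1-\varepsilon/2)\mu$ and $|\mathrm{supp}(y)|\le k\mu$ is an $(\varepsilon,\varepsilon/2)$-witness cover for $\mu$: it is a finite set of nonnegative vectors with $\sum_u y_u\le(1-\varepsilon/2)\mu$,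 and for every $c\in\mathbb Z_+^E$, if no $y\in W$ is dual feasible for $c$, then no $y\in\mathbb R_+^V$ with $\sum_u y_u\le(1-\varepsilon)\mu$ is dual feasible for $c$. (3) For every $B\in\mathbb Z_+$ there is a constant $C_B>0$ such that for every instance as above with $c_e^+\le B$ for all $e$, and every $\varepsilon\in(0,1)$, there are a positive number of colors and a number of iterations $$T\ \le\ C_B\,\frac{k\,\bigl(\log(k/(\varepsilon p))+1/\varepsilon\bigr)}{\varepsilon p},$$ both independent of the unknown distributions, with the following property. Color the vertices independently and uniformly at random, keep only the edges whose vertices have pairwise different colors, identify vertices of equal color, and run the adaptive strategy with $T$ iterations on the resulting hypergraph (whose vertices are the colors). The LP solutions and LP-relative $\alpha$-approximations needed exist, and for any choice of them the output is a $\frac{1-\varepsilon}{k-1+1/k}$-approximate matching of $(V,E)$ with probability at least $1-\varepsilon$, while for every vertex $u\in V$ the expected number of queried edges containing $u$ is at most $C_B\,k(\log(k/(\varepsilon p))+1/\varepsilon)/(\varepsilon p)$. -/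

import Mathlib

open scoped BigOperators ENNReal NNReal

noncomputable section

namespace StochMatching

/-! ### Random objects with finitely or countably many values -/

section Random

/-- The law of a family of independent random variables with laws `D e`. -/
def piPMF {E α : Type*} [Fintype E] [MeasurableSpace α] [MeasurableSingletonClass α] [Countable α]
    (D : E → PMF α) : PMF (E → α) :=
  (MeasureTheory.Measure.pi fun e => (D e).toMeasure).toPMF

theorem piPMF_apply {E α : Type*} [Fintype E] [MeasurableSpace α] [MeasurableSingletonClass α]
    [Countable α] (D : E → PMF α) (f : E → α) : piPMF D f = ∏ e, D e (f e) := by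
  rw [piPMF, MeasureTheory.Measure.toPMF_apply, MeasureTheory.Measure.pi_singleton]
  exact Finset.prod_congr rfl fun e _ => PMF.toMeasure_apply_singleton _ _ (measurableSet_singleton _)

/-- A coin that shows `true` with probability `x`, for `x ∈ [0, 1]` (other reals are clamped). -/
def coin (x : ℝ) : PMF Bool :=
  PMF.ofFintype
    (fun b => if b then ENNReal.ofReal (max 0 (min x 1)) else ENNReal.ofReal (1 - max 0 (min x 1)))
    (by
      have h0 : 0 ≤ max 0 (min x 1) := le_max_left _ _
      have h1 : max 0 (min x 1) ≤ 1 := max_le zero_le_one (min_le_right _ _)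
      rw [Fintype.sum_bool, if_pos rfl, if_neg (by decide),
        ← ENNReal.ofReal_add h0 (sub_nonneg.2 h1)]
      simp)

/-- A random subset of `E` which contains each `e` with probability `x e`, independently. -/
def randomSubset {E : Type*} [Fintype E] (x : E → ℝ) : PMF (Finset E) :=
  (piPMF fun e => coin (x e)).map fun b => Finset.univ.filter fun e => b e = true

/-- The expectation of a natural-number-valued function. -/
def expectation {α : Type*} (P : PMF α) (f : α → ℕ) : ℝ≥0∞ := ∑' a, P a * (f a : ℝ≥0∞)

/-- The probability of an event. -/
def prob {α : Type*} (P : PMF α) (S : Set α) : ℝ≥0∞ := P.toOuterMeasure S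

end Random

/-! ### Hypergraph matching and its linear programming relaxation

A hypergraph with vertex set `V` and edges indexed by `E` is given by `inc : E → Finset V`, the
set of vertices of each edge. Parallel edges are allowed here, since identifying vertices may
create them. -/

section Matching

variable {V E : Type*} [Fintype V] [DecidableEq V] [Fintype E] [DecidableEq E]

/-- Pairwise disjoint edges. -/
def IsMatching (inc : E → Finset V) (M : Finset E) : Prop :=
  ∀ u : V, (M.filter fun e => u ∈ inc e).card ≤ 1

/-- The total weight of a set of edges. -/
def weight (c : E → ℕ) (M : Finset E) : ℕ := ∑ e ∈ M, c e

/-- `M` is a matching whose weight is at least `ρ` times that of every matching. -/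
def IsApproxMatching (inc : E → Finset V) (c : E → ℕ) (ρ : ℝ) (M : Finset E) : Prop :=
  IsMatching inc M ∧ ∀ M' : Finset E, IsMatching inc M' → ρ * (weight c M' : ℝ) ≤ (weight c M : ℝ)

/-- Feasible points of the relaxation: `x ≥ 0` and `∑_{e ∋ u} x e ≤ 1` for every vertex `u`. -/
def LPFeasible (inc : E → Finset V) (x : E → ℝ) : Prop :=
  (∀ e, 0 ≤ x e) ∧ ∀ u : V, ∑ e ∈ Finset.univ.filter (fun e => u ∈ inc e), x e ≤ 1

def lpValue (c : E → ℕ) (x : E → ℝ) : ℝ := ∑ e, (c e : ℝ) * x e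

/-- Optimal solutions of the relaxation with objective vector `c`. -/
def LPOptimal (inc : E → Finset V) (c : E → ℕ) (x : E → ℝ) : Prop :=
  LPFeasible inc x ∧ ∀ x', LPFeasible inc x' → lpValue c x' ≤ lpValue c x

/-- Feasible points of the dual: `y ≥ 0` and `∑_{u ∈ e} y u ≥ c e` for every edge `e`. -/
def DualFeasible (inc : E → Finset V) (c : E → ℕ) (y : V → ℝ) : Prop :=
  (∀ u, 0 ≤ y u) ∧ ∀ e, (c e : ℝ) ≤ ∑ u ∈ inc e, y u

/-- Optimal solutions of the dual, whose objective is `∑ u, y u`. -/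
def DualOptimal (inc : E → Finset V) (c : E → ℕ) (y : V → ℝ) : Prop :=
  DualFeasible inc c y ∧ ∀ y', DualFeasible inc c y' → ∑ u, y u ≤ ∑ u, y' u

/-- The number of vertices on which `y` does not vanish. -/
def suppCard (y : V → ℝ) : ℕ := (Finset.univ.filter fun u => y u ≠ 0).card

/-- `(ε, ε')`-witness covers for `μ`, for the matching system of the hypergraph. -/
structure IsWitnessCover (inc : E → Finset V) (ε ε' μ : ℝ) (W : Set (V → ℝ)) : Prop where
  finite : W.Finite
  nonneg : ∀ y ∈ W, ∀ u, 0 ≤ y u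
  covers : ∀ c : E → ℕ, (∀ y ∈ W, ∃ e, ∑ u ∈ inc e, y u < (c e : ℝ)) →
    ∀ y : V → ℝ, (∀ u, 0 ≤ y u) → ∑ u, y u ≤ (1 - ε) * μ → ∃ e, ∑ u ∈ inc e, y u < (c e : ℝ)
  value_le : ∀ y ∈ W, ∑ u, y u ≤ (1 - ε') * μ

/-- The nonnegative vectors with entries in `(ε / (2 k)) ℤ`, with sum at most `(1 - ε / 2) μ`
and with at most `k μ` nonzero entries. -/
def sparseCover (V : Type*) [Fintype V] (k : ℕ) (ε μ : ℝ) : Set (V → ℝ) :=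
  {y | (∀ u, ∃ a : ℕ, y u = (a : ℝ) * (ε / (2 * k))) ∧ ∑ u, y u ≤ (1 - ε / 2) * μ ∧
    (suppCard y : ℝ) ≤ k * μ}

end Matching

/-! ### Stochastic weights and the adaptive strategy -/

section Strategy

variable {V E : Type*} [Fintype V] [DecidableEq V] [Fintype E] [DecidableEq E]

/-- `D e` is an admissible law of the weight of `e`: it lives on the integers from `cm e` to `cp e`
and gives the value `cp e` probability at least `p`. -/
def AdmissibleLaw (cm cp : E → ℕ) (p : ℝ) (D : E → PMF ℕ) : Prop :=
  ∀ e, (∀ a ∈ (D e).support, cm e ≤ a ∧ a ≤ cp e) ∧ ENNReal.ofReal p ≤ D e (cp e)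

/-- `max_e (cp e - cm e)` (and `0` if there are no edges). -/
def maxGap (cm cp : E → ℕ) : ℕ := Finset.univ.sup fun e => cp e - cm e

/-- The optimistic vector when the edges in `Q` have been queried and `c` is the realization. -/
def optimistic (cp : E → ℕ) (Q : Finset E) (c : E → ℕ) : E → ℕ :=
  fun e => if e ∈ Q then c e else cp e

/-- The pessimistic vector when the edges in `Q` have been queried and `c` is the realization. -/
def pessimistic (cm : E → ℕ) (Q : Finset E) (c : E → ℕ) : E → ℕ :=
  fun e => if e ∈ Q then c e else cm e

/-- A rule for solving the linear programs. It is given the number of the iteration, the set of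
queried edges and the objective vector. -/
abbrev Solver (E : Type*) := ℕ → Finset E → (E → ℕ) → E → ℝ

/-- A rule for choosing the final set of edges. It is given the set of queried edges and the
objective vector. -/
abbrev Rounding (E : Type*) := Finset E → (E → ℕ) → Finset E

/-- The solver always returns an optimal solution. -/
def IsSolver (inc : E → Finset V) (solve : Solver E) : Prop :=
  ∀ t Q c, LPOptimal inc c (solve t Q c)

/-- The rule is an LP-relative `α`-approximation: it returns a matching whose weight is at least
`α` times the optimal value of the relaxation. -/
def IsLPRelative (inc : E → Finset V) (α : ℝ) (round : Rounding E) : Prop :=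
  ∀ Q c, IsMatching inc (round Q c) ∧
    ∀ x, LPFeasible inc x → α * lpValue c x ≤ (weight c (round Q c) : ℝ)

/-- The law of the set of queried edges after `T` iterations when `c` is the realization: every
iteration solves the optimistic relaxation and queries each edge independently with the
probability given by the solution. Querying an edge again has no effect. -/
def queryLaw (cp : E → ℕ) (solve : Solver E) (c : E → ℕ) : ℕ → PMF (Finset E)
  | 0 => PMF.pure ∅
  | t + 1 => (queryLaw cp solve c t).bind fun Q =>
      (randomSubset (solve t Q (optimistic cp Q c))).map fun S => Q ∪ S

/-- What is recorded of one execution: the realized weights, the queried edges, the output. -/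
structure Run (E : Type*) where
  realized : E → ℕ
  queried : Finset E
  output : Finset E

/-- The adaptive strategy with `T` iterations: nature draws the weights independently, the
iterations query edges, and the final rule is applied to the pessimistic relaxation. -/
def adaptiveStrategy (cm cp : E → ℕ) (solve : Solver E) (round : Rounding E) (T : ℕ)
    (D : E → PMF ℕ) : PMF (Run E) :=
  (piPMF D).bind fun c => (queryLaw cp solve c T).map fun Q =>
    ⟨c, Q, round Q (pessimistic cm Q c)⟩

/-- The edges whose vertices have pairwise different colours under `χ`. -/
abbrev Colorful {K : Type*} [DecidableEq K] (inc : E → Finset V) (χ : V → K) : Type _ :=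
  {e : E // ((inc e).image χ).card = (inc e).card}

/-- The sparsified hypergraph: its vertices are the colours, its edges the colourful edges. -/
def colorInc {K : Type*} [DecidableEq K] (inc : E → Finset V) (χ : V → K) :
    Colorful inc χ → Finset K :=
  fun e => (inc e.1).image χ

/-- The adaptive strategy after vertex sparsification: the vertices get independent uniform colours
from a set of `N + 1` colours, and the adaptive strategy with `T` iterations is run on the
sparsified hypergraph. -/
def sparsifiedStrategy (inc : E → Finset V) (cm cp : E → ℕ) (N : ℕ)
    (solve : ∀ χ : V → Fin (N + 1), Solver (Colorful inc χ))
    (round : ∀ χ : V → Fin (N + 1), Rounding (Colorful inc χ)) (T : ℕ)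
    (D : E → PMF ℕ) : PMF (Run E) :=
  (PMF.uniformOfFintype (V → Fin (N + 1))).bind fun χ => (piPMF D).bind fun c =>
    (queryLaw (fun e : Colorful inc χ => cp e.1) (solve χ) (fun e => c e.1) T).map fun Q =>
      ⟨c, Q.map (Function.Embedding.subtype _),
        (round χ Q (pessimistic (fun e => cm e.1) Q fun e => c e.1)).map
          (Function.Embedding.subtype _)⟩

/-- The number of queried edges which contain the vertex `u`. -/
def queriesAt (inc : E → Finset V) (u : V) (r : Run E) : ℕ :=
  (r.queried.filter fun e => u ∈ inc e).card

/-- The executions whose output is a `ρ`-approximate matching for the realized weights. -/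
def goodRuns (inc : E → Finset V) (ρ : ℝ) : Set (Run E) :=
  {r | IsApproxMatching inc r.realized ρ r.output}

end Strategy

/-- `1 / (k - 1 + 1 / k)`. -/
def ratio (k : ℕ) : ℝ := 1 / ((k : ℝ) - 1 + 1 / (k : ℝ))

/-- The edges of a set family, with their vertex sets. -/
def edgeSet {V : Type*} (H : Finset (Finset V)) : H → Finset V := fun e => e.1

end StochMatching

end

set_option linter.unusedSectionVars false

namespace StochMatching

/-! ### Duality and complementary slackness for the matching relaxation. -/

section LinearProgram

variable {V E : Type*} [Fintype V] [DecidableEq V] [Fintype E]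

/-! A vector `y` certifies a small pessimistic optimum if it is dual feasible for the pessimistic
weights. Suppose that `∑ y ≤ μ - η` while the optimistic value is still at least `μ`. An optimal `x`
of the optimistic relaxation has value at least `μ`, and its edges are worth at most `∑ y` when
priced by `y`. The difference, at least `η`, can only come from unqueried edges whose optimistic
weight exceeds their price, and each such edge contributes at most `Δ * x e`. Hence these edges
carry fractional mass at least `η / Δ`. Each of them is queried with probability `x e`, and
independently shows its maximal weight with probability at least `p`, which destroys `y`. So `y`
survives one iteration with probability at most `exp (-p η / Δ)`. Unqueried weights are still fresh
(`mean_resample`, `queryLaw_congr`), so these bounds multiply over the iterations (`mean_alive_le`).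

If the final pessimistic optimum is too small, its optimal dual solution has small support by
complementary slackness. Rounding up to multiples of `ε / (2k)` therefore costs only a factor `1 + ε
/ 2` (`exists_grid_dualFeasible`), and the same rounding gives the sparse witness cover. The union
bound over grid vectors (`mean_fails_le`) needs no guess of the optimum: each vector `a` is tested
at the value `μ a` dictated by its own sum `S`. Its survival probability `exp (-b μ a)` pays for
`μ₀`, for `S` and, since the support has at most `k S` elements, for the support. The resulting sum
factorizes over the vertices into geometric series.

The final matching loses the factor `k - 1 + 1/k` to the relaxation. This integrality gap is proved
by local ratio on a sparse fractional solution (`LPFeasible.exists_matching`).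

For bounded weights the factor `log n` is removed by colouring with about `8 k² m / ε²` colours, `m`
being the optimistic value. An optimal matching has at most `m` edges, and few of them clash.
Concentration of the value of one fixed fractional solution shows that, when `m` is large, the
realized optimum is typically at least of order `p m / k`. The number of vertices after
identification is thus bounded by `μ₀` times a quantity independent of `n`, and the same union bound
applies. -/

theorem sum_edge_mul_comm (inc : E → Finset V) (x : E → ℝ) (y : V → ℝ) :
    ∑ e, (∑ u ∈ inc e, y u) * x e
      = ∑ u, y u * ∑ e ∈ Finset.univ.filter (fun e => u ∈ inc e), x e := by
  have h1 : ∀ e, (∑ u ∈ inc e, y u) * x e = ∑ u, if u ∈ inc e then y u * x e else 0 := fun e => by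
    rw [Finset.sum_mul, ← Finset.sum_filter]
    exact Finset.sum_congr (by ext; simp) fun _ _ => rfl
  simp_rw [h1, Finset.mul_sum, Finset.sum_filter]
  exact Finset.sum_comm

theorem LPFeasible.sum_edge_mul_le {inc : E → Finset V} {x : E → ℝ} (hx : LPFeasible inc x)
    {y : V → ℝ} (hy : ∀ u, 0 ≤ y u) : ∑ e, (∑ u ∈ inc e, y u) * x e ≤ ∑ u, y u := by
  rw [sum_edge_mul_comm]
  exact Finset.sum_le_sum fun u _ => mul_le_of_le_one_right (hy u) (hx.2 u)

theorem lpValue_le_of_dualFeasible {inc : E → Finset V} {c : E → ℕ} {x : E → ℝ} {y : V → ℝ}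
    (hx : LPFeasible inc x) (hy : DualFeasible inc c y) : lpValue c x ≤ ∑ u, y u :=
  (Finset.sum_le_sum fun e _ => mul_le_mul_of_nonneg_right (hy.2 e) (hx.1 e)).trans
    (hx.sum_edge_mul_le hy.1)

theorem lpFeasible_zero (inc : E → Finset V) : LPFeasible inc (0 : E → ℝ) :=
  ⟨fun _ => le_rfl, fun u => by simp⟩

theorem lpValue_zero (c : E → ℕ) : lpValue c (0 : E → ℝ) = 0 := by simp [lpValue]

theorem lpValue_nonneg (c : E → ℕ) {x : E → ℝ} (hx : ∀ e, 0 ≤ x e) : 0 ≤ lpValue c x :=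
  Finset.sum_nonneg fun e _ => mul_nonneg (Nat.cast_nonneg _) (hx e)

theorem lpValue_mono {c c' : E → ℕ} (h : ∀ e, c e ≤ c' e) {x : E → ℝ} (hx : ∀ e, 0 ≤ x e) :
    lpValue c x ≤ lpValue c' x :=
  Finset.sum_le_sum fun e _ => mul_le_mul_of_nonneg_right (Nat.cast_le.2 (h e)) (hx e)

theorem LPOptimal.nonneg {inc : E → Finset V} {c : E → ℕ} {x : E → ℝ} (hx : LPOptimal inc c x) :
    0 ≤ lpValue c x := lpValue_nonneg c hx.1.1

theorem LPFeasible.le_one {inc : E → Finset V} (hne : ∀ e, (inc e).Nonempty) {x : E → ℝ}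
    (hx : LPFeasible inc x) (e : E) : x e ≤ 1 := by
  obtain ⟨u, hu⟩ := hne e
  refine le_trans ?_ (hx.2 u)
  exact Finset.single_le_sum (f := x) (fun i _ => hx.1 i) (by simp [hu])

/-- The feasible region is compact because nonempty edges force `x e ≤ 1`; an empty edge would be
unconstrained from above. -/
theorem exists_lpOptimal {inc : E → Finset V} (hne : ∀ e, (inc e).Nonempty) (c : E → ℕ) :
    ∃ x, LPOptimal inc c x := by
  have hK : IsCompact {x : E → ℝ | LPFeasible inc x} := by
    refine (isCompact_univ_pi fun _ : E => isCompact_Icc (a := (0 : ℝ)) (b := 1)).of_isClosed_subset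
      ?_ fun x hx => Set.mem_univ_pi.2 fun e => ⟨hx.1 e, LPFeasible.le_one hne hx e⟩
    simp only [LPFeasible, Set.ofPred_and, Set.ofPred_forall]
    refine (isClosed_iInter fun e => isClosed_le continuous_const (continuous_apply e)).inter
      (isClosed_iInter fun u => isClosed_le ?_ continuous_const)
    exact continuous_finsetSum _ fun e _ => continuous_apply e
  obtain ⟨x, hx, hmax⟩ := hK.exists_isMaxOn ⟨0, lpFeasible_zero inc⟩
    (f := lpValue c) (by unfold lpValue; fun_prop)
  exact ⟨x, hx, fun x' hx' => hmax hx'⟩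

/-- Strong duality for the matching relaxation. -/
theorem LPOptimal.exists_dualFeasible {inc : E → Finset V} {c : E → ℕ} {x : E → ℝ}
    (hx : LPOptimal inc c x) : ∃ y, DualFeasible inc c y ∧ ∑ u, y u ≤ lpValue c x := by
  classical
  set v := lpValue c x with hv
  let load : (E → ℝ) → V → ℝ := fun x u => ∑ e ∈ Finset.univ.filter (fun e => u ∈ inc e), x e
  -- Right-hand sides and values that are strictly beaten by some nonnegative `x`. Strictness makes
  -- `S` open, so the optimal pair `(1, v)`, which lies outside `S`, can be separated from it; the
  -- functional supplies the dual prices `y` and a multiplier `η`.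
  let S : Set ((V → ℝ) × ℝ) :=
    {q | ∃ x : E → ℝ, (∀ e, 0 ≤ x e) ∧ (∀ u, load x u < q.1 u) ∧ q.2 < lpValue c x}
  have hload : ∀ (a b : ℝ) (x x' : E → ℝ) u,
      load (a • x + b • x') u = a * load x u + b * load x' u := fun a b x x' u => by
    simp [load, Finset.sum_add_distrib, Finset.mul_sum]
  have hval : ∀ (a b : ℝ) (x x' : E → ℝ),
      lpValue c (a • x + b • x') = a * lpValue c x + b * lpValue c x' := fun a b x x' => by
    simp only [lpValue, Finset.mul_sum, ← Finset.sum_add_distrib]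
    exact Finset.sum_congr rfl fun e _ => by simp; ring
  have hconv : Convex ℝ S := by
    rintro q ⟨x, hx0, hx1, hx2⟩ q' ⟨x', hx0', hx1', hx2'⟩ a b ha hb hab
    refine ⟨a • x + b • x', fun e => ?_, fun u => ?_, ?_⟩
    · have := hx0 e; have := hx0' e; simp only [Pi.add_apply, Pi.smul_apply, smul_eq_mul]; positivity
    · rw [hload]
      simp only [Prod.fst_add, Prod.smul_fst, Pi.add_apply, Pi.smul_apply, smul_eq_mul]
      rcases ha.eq_or_lt with rfl | ha
      · have : b = 1 := by linarith
        subst this; linarith [hx1' u]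
      · have := mul_lt_mul_of_pos_left (hx1 u) ha
        have := mul_le_mul_of_nonneg_left (hx1' u).le hb
        linarith
    · rw [hval]
      simp only [Prod.snd_add, Prod.smul_snd, smul_eq_mul]
      rcases ha.eq_or_lt with rfl | ha
      · have : b = 1 := by linarith
        subst this; linarith
      · have := mul_lt_mul_of_pos_left hx2 ha
        have := mul_le_mul_of_nonneg_left hx2'.le hb
        linarith
  have hopen : IsOpen S := by
    have : S = ⋃ x ∈ {x : E → ℝ | ∀ e, 0 ≤ x e},
        {q : (V → ℝ) × ℝ | (∀ u, load x u < q.1 u) ∧ q.2 < lpValue c x} := by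
      ext q; simp only [S, Set.mem_ofPred_eq, Set.mem_iUnion, exists_prop]
    rw [this]
    refine isOpen_biUnion fun x _ => ?_
    simp only [Set.ofPred_and, Set.ofPred_forall]
    refine (isOpen_iInter_of_finite fun u => isOpen_lt continuous_const (by fun_prop)).inter
      (isOpen_lt (by fun_prop) continuous_const)
  have hdisj : ((fun _ => 1, v) : (V → ℝ) × ℝ) ∉ S := by
    rintro ⟨x', h0, h1, h2⟩
    exact absurd (hx.2 x' ⟨h0, fun u => (h1 u).le⟩) (not_le.2 h2)
  obtain ⟨f, hf⟩ := geometric_hahn_banach_open_point hconv hopen hdisj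
  let y : V → ℝ := fun u => - f (Pi.single u 1, 0)
  let η : ℝ := f (0, 1)
  have hf_apply : ∀ z r, f (z, r) = η * r - ∑ u, y u * z u := by
    intro z r
    have h1 : ((z, r) : (V → ℝ) × ℝ)
        = r • ((0, 1) : (V → ℝ) × ℝ) + ∑ u, z u • ((Pi.single u 1, 0) : (V → ℝ) × ℝ) := by
      ext w
      · simp [Prod.fst_sum, Finset.sum_apply, Pi.single_apply]
      · simp [Prod.snd_sum]
    rw [h1, map_add, map_smul, map_sum]
    simp only [map_smul, smul_eq_mul, y, η, neg_mul, Finset.sum_neg_distrib, sub_neg_eq_add]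
    congr 1
    · ring
    · exact Finset.sum_congr rfl fun u _ => mul_comm _ _
  have hsep : ∀ (x : E → ℝ), (∀ e, 0 ≤ x e) → ∀ (z : V → ℝ) (r : ℝ), (∀ u, load x u < z u) →
      r < lpValue c x → η * r - ∑ u, y u * z u < η * v - ∑ u, y u := by
    intro x hx z r hz hr
    have := hf (z, r) ⟨x, hx, hz, hr⟩
    rw [hf_apply, hf_apply] at this
    simpa using this
  have hload0 : ∀ u, load 0 u = 0 := fun u => by simp [load]
  have hlim : ∀ A K : ℝ, (∀ t : ℝ, 0 < t → t * A < K) → A ≤ 0 := by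
    intro A K h
    by_contra! hA
    have := h ((|K| + 1) / A) (by positivity)
    rw [div_mul_cancel₀ _ hA.ne'] at this
    linarith [le_abs_self K]
  have hy0 : ∀ u, 0 ≤ y u := by
    intro u
    have := hlim (- y u) (η * v - ∑ u, y u + η + ∑ u, y u) fun t ht => by
      have := hsep 0 (fun _ => le_rfl) (fun w => 1 + if w = u then t else 0) (-1)
        (fun w => by rw [hload0]; split_ifs <;> linarith) (by rw [lpValue_zero]; norm_num)
      simp only [mul_add, mul_one, Finset.sum_add_distrib, mul_ite, mul_zero, Finset.sum_ite_eq',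
        Finset.mem_univ, if_true] at this
      linarith
    linarith
  have hη0 : 0 ≤ η := by
    have := hlim (- η) (η * v - ∑ u, y u + ∑ u, y u) fun t ht => by
      have := hsep 0 (fun _ => le_rfl) (fun w => 1) (-t)
        (fun w => by rw [hload0]; norm_num) (by rw [lpValue_zero]; linarith)
      simp only [mul_one] at this
      linarith
    linarith
  -- Slater's condition: `x = 0` satisfies all the constraints strictly. With `η = 0`, testing at
  -- the constant right-hand side `1 / 2` would give `∑ y < ∑ y / 2`.
  have hη : 0 < η := by
    refine lt_of_le_of_ne hη0 fun h0 => ?_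
    have := hsep 0 (fun _ => le_rfl) (fun w => 1 / 2) (-1)
      (fun w => by rw [hload0]; norm_num) (by rw [lpValue_zero]; norm_num)
    rw [← h0, ← Finset.sum_mul] at this
    have := Finset.sum_nonneg fun u (_ : u ∈ Finset.univ) => hy0 u
    linarith
  have hclosed : ∀ (x : E → ℝ), (∀ e, 0 ≤ x e) →
      η * lpValue c x - ∑ u, y u * load x u ≤ η * v - ∑ u, y u := by
    intro x hx
    refine le_of_forall_pos_le_add fun δ hδ => ?_
    have hY := Finset.sum_nonneg fun u (_ : u ∈ Finset.univ) => hy0 u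
    set Y := ∑ u, y u
    have hpos : 0 < η + Y := by linarith
    have := hsep x hx (fun u => load x u + δ / (η + Y)) (lpValue c x - δ / (η + Y))
      (fun u => by have : 0 < δ / (η + Y) := by positivity
                   linarith) (by have : 0 < δ / (η + Y) := by positivity
                                 linarith)
    simp only [mul_add, Finset.sum_add_distrib, ← Finset.sum_mul] at this
    have h2 : (η + Y) * (δ / (η + Y)) = δ := by field_simp
    nlinarith
  refine ⟨fun u => y u / η, ⟨fun u => div_nonneg (hy0 u) hη.le, fun e => ?_⟩, ?_⟩
  · rw [← Finset.sum_div, le_div_iff₀ hη]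
    -- Scaling a single coordinate to infinity yields the dual constraint of that edge.
    have := hlim (η * c e - ∑ u ∈ inc e, y u) (η * v - ∑ u, y u + 1) fun t ht => by
      have := hclosed (Pi.single e t) fun e' => by
        by_cases h : e' = e
        · subst h; simpa using ht.le
        · simp [h]
      have h2 := sum_edge_mul_comm inc (Pi.single e t) y
      simp only [Pi.single_apply, mul_ite, mul_zero, Finset.sum_ite_eq', Finset.mem_univ,
        if_true] at h2
      have h3 : lpValue c (Pi.single e t) = c e * t := by
        simp [lpValue, Pi.single_apply]
      have h4 : ∑ u, y u * load (Pi.single e t) u = (∑ u ∈ inc e, y u) * t := by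
        rw [h2]; simp [load]
      rw [h3, h4] at this
      linarith
    linarith
  · rw [← Finset.sum_div, div_le_iff₀ hη]
    have := hclosed 0 fun _ => le_rfl
    simp only [lpValue_zero, hload0, mul_zero, Finset.sum_const_zero] at this
    linarith

theorem LPOptimal.dualOptimal_of_le {inc : E → Finset V} {c : E → ℕ} {x : E → ℝ} {y : V → ℝ}
    (hx : LPOptimal inc c x) (hy : DualFeasible inc c y) (h : ∑ u, y u ≤ lpValue c x) :
    DualOptimal inc c y :=
  ⟨hy, fun _ hy' => h.trans (lpValue_le_of_dualFeasible hx.1 hy')⟩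

/-- By complementary slackness, dual solutions of optimal value have small support. -/
theorem LPOptimal.suppCard_le {inc : E → Finset V} {k : ℕ} (hk : ∀ e, (inc e).card = k)
    {c : E → ℕ} {x : E → ℝ} {y : V → ℝ} (hx : LPOptimal inc c x) (hy : DualFeasible inc c y)
    (h : ∑ u, y u ≤ lpValue c x) : (suppCard y : ℝ) ≤ k * lpValue c x := by
  -- Dropping edges of weight zero keeps the value. Afterwards `x' e ≤ c e * x' e` by integrality,
  -- so the total mass of `x'` is at most the optimal value. Every vertex of the support of `y` is
  -- tight for `x'`, and counting loads spends each unit of mass `k` times.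
  let x' : E → ℝ := fun e => if c e = 0 then 0 else x e
  have hx'0 : ∀ e, 0 ≤ x' e := fun e => by
    simp only [x']; split_ifs; exacts [le_rfl, hx.1.1 e]
  have hx'le : ∀ e, x' e ≤ x e := fun e => by
    simp only [x']; split_ifs; exacts [hx.1.1 e, le_rfl]
  have hx' : LPFeasible inc x' :=
    ⟨hx'0, fun u => (Finset.sum_le_sum fun e _ => hx'le e).trans (hx.1.2 u)⟩
  have hval : lpValue c x' = lpValue c x := Finset.sum_congr rfl fun e _ => by
    simp only [x']; split_ifs with h0 <;> simp [h0]
  have h1 : ∑ u, y u * (1 - ∑ e ∈ Finset.univ.filter (fun e => u ∈ inc e), x' e) ≤ 0 := by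
    simp only [mul_sub, mul_one, Finset.sum_sub_distrib]
    rw [← sum_edge_mul_comm]
    have : lpValue c x' ≤ ∑ e, (∑ u ∈ inc e, y u) * x' e :=
      Finset.sum_le_sum fun e _ => mul_le_mul_of_nonneg_right (hy.2 e) (hx'0 e)
    linarith
  have hnn : ∀ u ∈ Finset.univ,
      0 ≤ y u * (1 - ∑ e ∈ Finset.univ.filter (fun e => u ∈ inc e), x' e) :=
    fun u _ => mul_nonneg (hy.1 u) (sub_nonneg.2 (hx'.2 u))
  have htight := (Finset.sum_eq_zero_iff_of_nonneg hnn).1 (le_antisymm h1 (Finset.sum_nonneg hnn))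
  have h2 : (suppCard y : ℝ)
      ≤ ∑ u, (1 : ℝ) * ∑ e ∈ Finset.univ.filter (fun e => u ∈ inc e), x' e := by
    rw [suppCard, Finset.card_eq_sum_ones, Nat.cast_sum, Finset.sum_filter]
    refine Finset.sum_le_sum fun u hu => ?_
    split_ifs with h0
    · have := (mul_eq_zero.1 (htight u hu)).resolve_left h0
      push_cast; linarith
    · rw [one_mul]; exact Finset.sum_nonneg fun e _ => hx'0 e
  rw [← sum_edge_mul_comm] at h2
  refine h2.trans ?_
  rw [← hval, lpValue, Finset.mul_sum]
  refine Finset.sum_le_sum fun e _ => ?_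
  rw [Finset.sum_const, hk, nsmul_eq_mul, mul_one]
  by_cases h0 : c e = 0
  · simp [x', h0]
  · have : (1 : ℝ) ≤ c e := by exact_mod_cast Nat.one_le_iff_ne_zero.2 h0
    have := hx'0 e
    have : x' e ≤ c e * x' e := by nlinarith
    gcongr

end LinearProgram

/-! ### Grid rounding of dual solutions, the integrality gap, and the witness cover. -/

section Rounding

variable {V E : Type*} [Fintype V] [DecidableEq V] [Fintype E]

/-- Rounding an optimal dual solution up to a grid. -/
theorem LPOptimal.exists_grid_dualFeasible {inc : E → Finset V} {k : ℕ}
    (hk : ∀ e, (inc e).card = k) {c : E → ℕ} {x : E → ℝ} (hx : LPOptimal inc c x) {δ : ℝ}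
    (hδ : 0 < δ) : ∃ a : V → ℕ, DualFeasible inc c (fun u => a u * δ) ∧
      ∑ u, (a u : ℝ) * δ ≤ (1 + k * δ) * lpValue c x ∧
      ((Finset.univ.filter fun u => a u ≠ 0).card : ℝ) ≤ k * lpValue c x ∧
      ((Finset.univ.filter fun u => a u ≠ 0).card : ℝ) ≤ k * ∑ u, (a u : ℝ) * δ := by
  obtain ⟨y, hy, hval⟩ := hx.exists_dualFeasible
  have hsupp := hx.suppCard_le hk hy hval
  have hle : ∀ u, y u ≤ ⌈y u / δ⌉₊ * δ := fun u => (div_le_iff₀ hδ).1 (Nat.le_ceil _)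
  have hfeas : DualFeasible inc c (fun u => (⌈y u / δ⌉₊ : ℝ) * δ) :=
    ⟨fun u => (hy.1 u).trans (hle u), fun e => (hy.2 e).trans (Finset.sum_le_sum fun u _ => hle u)⟩
  -- Rounding up keeps zeros, so the additional cost is at most `δ` for each of the at most `k *
  -- lpValue c x` support vertices.
  have hiff : ∀ u, ⌈y u / δ⌉₊ ≠ 0 ↔ y u ≠ 0 := fun u => by
    rw [Ne, Nat.ceil_eq_zero, not_le]
    exact ⟨fun h h0 => by simp [h0] at h, fun h => div_pos ((hy.1 u).lt_of_ne' h) hδ⟩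
  have hcard : ((Finset.univ.filter fun u => ⌈y u / δ⌉₊ ≠ 0).card : ℝ) ≤ k * lpValue c x := by
    simpa only [hiff, suppCard] using hsupp
  refine ⟨fun u => ⌈y u / δ⌉₊, hfeas, ?_, hcard, ?_⟩
  · have h1 : ∑ u, (⌈y u / δ⌉₊ : ℝ) * δ ≤ ∑ u, (y u + if y u ≠ 0 then δ else 0) := by
      refine Finset.sum_le_sum fun u _ => ?_
      split_ifs with h
      · have := (Nat.ceil_lt_add_one (div_nonneg (hy.1 u) hδ.le)).le
        calc (⌈y u / δ⌉₊ : ℝ) * δ ≤ (y u / δ + 1) * δ := by gcongr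
          _ = y u + δ := by field_simp
      · rw [not_not] at h; simp [h]
    rw [Finset.sum_add_distrib, ← Finset.sum_filter, Finset.sum_const, nsmul_eq_mul] at h1
    have : (suppCard y : ℝ) * δ ≤ k * lpValue c x * δ := by gcongr
    unfold suppCard at this
    linarith
  · exact hcard.trans (mul_le_mul_of_nonneg_left (lpValue_le_of_dualFeasible hx.1 hfeas)
      (Nat.cast_nonneg _))

theorem isMatching_iff {inc : E → Finset V} {M : Finset E} : IsMatching inc M ↔
    ∀ u, ∀ e ∈ M, ∀ e' ∈ M, u ∈ inc e → u ∈ inc e' → e = e' := by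
  refine forall_congr' fun u => ?_
  rw [Finset.card_le_one]
  simp only [Finset.mem_filter]
  exact ⟨fun h e he e' he' h1 h2 => h e ⟨he, h1⟩ e' ⟨he', h2⟩,
    fun h e he e' he' => h e he.1 e' he'.1 he.2 he'.2⟩

/-- Local ratio: if every set of edges in `F` has an edge whose closed neighbourhood has fractional
weight at most `β`, then some matching has at least `1 / β` of the fractional weight. -/
theorem exists_matching_of_peeling [DecidableEq E] (inc : E → Finset V)
    (hne : ∀ e, (inc e).Nonempty) (x : E → ℝ) (hx : ∀ e, 0 ≤ x e) (β : ℝ) (hβ : 0 ≤ β)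
    (F : Finset E) (h : ∀ G ⊆ F, G.Nonempty → ∃ e ∈ G,
      ∑ e' ∈ G.filter (fun e' => ¬ Disjoint (inc e') (inc e)), x e' ≤ β) (w : E → ℝ) :
    ∃ M ⊆ F, IsMatching inc M ∧ ∑ e ∈ F, w e * x e ≤ β * ∑ e ∈ M, w e := by
  induction F using Finset.strongInduction generalizing w with
  | H F ih =>
  rcases F.eq_empty_or_nonempty with rfl | hF
  · exact ⟨∅, subset_rfl, fun u => by simp, by simp⟩
  have ihe : ∀ e ∈ F, ∀ w : E → ℝ, ∃ M ⊆ F.erase e, IsMatching inc M ∧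
      ∑ e ∈ F.erase e, w e * x e ≤ β * ∑ e ∈ M, w e := fun e he w =>
    ih _ (Finset.erase_ssubset he) (fun G hG => h G (hG.trans (Finset.erase_subset _ _))) w
  -- The weights are real because the reduction below may make them negative; edges of nonpositive
  -- weight can be discarded.
  by_cases hw : ∃ e ∈ F, w e ≤ 0
  · obtain ⟨e, he, hwe⟩ := hw
    obtain ⟨M, hM, hM', hle⟩ := ihe e he w
    refine ⟨M, hM.trans (Finset.erase_subset _ _), hM', ?_⟩
    rw [← Finset.add_sum_erase _ _ he]
    have := mul_nonpos_of_nonpos_of_nonneg hwe (hx e)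
    linarith
  push Not at hw
  obtain ⟨e, he, hsum⟩ := h F subset_rfl hF
  -- Subtracting `w e` on the closed neighbourhood of `e` lowers the fractional value by at most `β
  -- * w e`. A matching for `w'` recovers `w e`: either it already meets this neighbourhood, or `e`
  -- can be added to it.
  let w' : E → ℝ := fun e' => w e' - if ¬ Disjoint (inc e') (inc e) then w e else 0
  have hself : ¬ Disjoint (inc e) (inc e) := by
    rw [disjoint_self]; exact (hne e).ne_empty
  have hw'e : w' e = 0 := by simp only [w', if_pos hself, sub_self]
  obtain ⟨M, hM, hM', hle⟩ := ihe e he w'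
  have hMF : M ⊆ F := hM.trans (Finset.erase_subset _ _)
  have hFw : ∑ e' ∈ F, w e' * x e' ≤ (∑ e' ∈ F.erase e, w' e' * x e') + w e * β := by
    have h1 : ∑ e' ∈ F, w e' * x e' = ∑ e' ∈ F, w' e' * x e' +
        w e * ∑ e' ∈ F.filter (fun e' => ¬ Disjoint (inc e') (inc e)), x e' := by
      rw [Finset.mul_sum, Finset.sum_filter, ← Finset.sum_add_distrib]
      refine Finset.sum_congr rfl fun e' _ => ?_
      simp only [w']; split_ifs <;> ring
    rw [h1, ← Finset.add_sum_erase _ _ he, hw'e, zero_mul, zero_add]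
    exact add_le_add_right (mul_le_mul_of_nonneg_left hsum (hw e he).le) _
  have key : ∃ M' ⊆ F, IsMatching inc M' ∧ ∑ e ∈ M, w' e + w e ≤ ∑ e ∈ M', w e := by
    by_cases hint : ∃ e' ∈ M, ¬ Disjoint (inc e') (inc e)
    · obtain ⟨e', he', hd⟩ := hint
      refine ⟨M, hMF, hM', ?_⟩
      simp only [w', Finset.sum_sub_distrib]
      have : w e ≤ ∑ e' ∈ M, if ¬ Disjoint (inc e') (inc e) then w e else 0 := by
        refine le_trans (by rw [if_pos hd]) (Finset.single_le_sum
          (f := fun e' => if ¬ Disjoint (inc e') (inc e) then w e else 0) (fun i _ => ?_) he')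
        split_ifs
        exacts [le_rfl, (hw e he).le]
      linarith
    · push Not at hint
      have heM : e ∉ M := fun h' => hself (hint e h')
      refine ⟨insert e M, Finset.insert_subset he hMF, ?_, ?_⟩
      · rw [isMatching_iff] at hM' ⊢
        intro u a ha b hb hua hub
        rcases Finset.mem_insert.1 ha with rfl | ha' <;> rcases Finset.mem_insert.1 hb with rfl | hb'
        · rfl
        · exact absurd hua (Finset.disjoint_left.1 (hint b hb') hub)
        · exact absurd hub (Finset.disjoint_left.1 (hint a ha') hua)
        · exact hM' u a ha' b hb' hua hub
      · rw [Finset.sum_insert heM, add_comm]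
        refine add_le_add_right (Finset.sum_le_sum fun e' he' => ?_) _
        simp only [w', if_neg (not_not.2 (hint e' he')), sub_zero, le_refl]
  obtain ⟨M', hM'F, hMat, hge⟩ := key
  refine ⟨M', hM'F, hMat, ?_⟩
  have := mul_le_mul_of_nonneg_left hge hβ
  linarith

/-- Every feasible point can be replaced by one which is at least as good and in whose support every
nonempty set of edges has a vertex of positive degree at most `k`. -/
theorem LPFeasible.exists_sparse [DecidableEq E] {inc : E → Finset V} {k : ℕ} (hk0 : 1 ≤ k)
    (hk : ∀ e, (inc e).card = k) (c : E → ℕ) {x : E → ℝ} (hx : LPFeasible inc x) :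
    ∃ x', LPFeasible inc x' ∧ lpValue c x ≤ lpValue c x' ∧
      ∀ G ⊆ Finset.univ.filter (fun e => x' e ≠ 0), G.Nonempty → ∃ u,
        (G.filter fun e => u ∈ inc e).Nonempty ∧ (G.filter fun e => u ∈ inc e).card ≤ k := by
  induction hm : (Finset.univ.filter fun e => x e ≠ 0).card using Nat.strong_induction_on
    generalizing x with
  | _ m ih =>
  by_cases hG : ∀ G ⊆ Finset.univ.filter (fun e => x e ≠ 0), G.Nonempty → ∃ u,
        (G.filter fun e => u ∈ inc e).Nonempty ∧ (G.filter fun e => u ∈ inc e).card ≤ k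
  · exact ⟨x, hx, le_rfl, hG⟩
  push Not at hG
  obtain ⟨G, hGs, ⟨e₀, he₀⟩, hdeg⟩ := hG
  let U : Finset V := Finset.univ.filter fun u => (G.filter fun e => u ∈ inc e).Nonempty
  -- If all touched vertices had degree at least `k + 1`, double counting incidences would give `(k
  -- + 1) |U| ≤ k |G|`. Hence there are fewer constraints than variables, and the load map on `G`
  -- has a kernel.
  have hcard : U.card < G.card := by
    have h1 : ∑ u ∈ U, (G.filter fun e => u ∈ inc e).card ≤ ∑ e ∈ G, (inc e).card := by
      refine (Finset.sum_card_bipartiteAbove_eq_sum_card_bipartiteBelow (s := G) (t := U)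
        (fun e u => u ∈ inc e)).symm.trans_le ?_
      exact Finset.sum_le_sum fun e _ => Finset.card_le_card fun u hu => by
        simpa [Finset.bipartiteAbove] using (Finset.mem_filter.1 hu).2
    have h2 : U.card * (k + 1) ≤ ∑ u ∈ U, (G.filter fun e => u ∈ inc e).card := by
      rw [← smul_eq_mul]
      exact Finset.card_nsmul_le_sum _ _ _ fun u hu => hdeg u (Finset.mem_filter.1 hu).2
    have h3 : ∑ e ∈ G, (inc e).card = G.card * k := by
      rw [Finset.sum_congr rfl fun e _ => hk e, Finset.sum_const, smul_eq_mul]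
    have hpos : 0 < G.card := Finset.card_pos.2 ⟨e₀, he₀⟩
    by_contra! hle
    have : G.card * (k + 1) ≤ U.card * (k + 1) := Nat.mul_le_mul_right _ hle
    nlinarith
  -- a direction in which the load of every vertex is constant
  have hdir : ∃ d : E → ℝ, (∃ e, d e < 0) ∧ (∀ e, x e = 0 → d e = 0) ∧ 0 ≤ lpValue c d ∧
      ∀ u, ∑ e ∈ Finset.univ.filter (fun e => u ∈ inc e), d e = 0 := by
    let A : Matrix U G ℝ := Matrix.of fun u e => if (u : V) ∈ inc e then 1 else 0
    have hker : LinearMap.ker (Matrix.mulVecLin A) ≠ ⊥ := by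
      refine LinearMap.ker_ne_bot_of_finrank_lt ?_
      simpa using hcard
    obtain ⟨v, hv, hv0⟩ := Submodule.exists_mem_ne_zero_of_ne_bot hker
    have hv' : ∀ u : U, ∑ e : G, (if (u : V) ∈ inc e then v e else 0) = 0 := fun u => by
      have := congrFun (LinearMap.mem_ker.1 hv) u
      simpa [Matrix.mulVec, dotProduct, A] using this
    have main : ∃ d : E → ℝ, d ≠ 0 ∧ (∀ e, e ∉ G → d e = 0) ∧
        ∀ u, ∑ e ∈ Finset.univ.filter (fun e => u ∈ inc e), d e = 0 := by
      refine ⟨fun e => if h : e ∈ G then v ⟨e, h⟩ else 0, fun h => hv0 ?_, fun e he => by simp [he],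
        fun u => ?_⟩
      · funext e
        have := congrFun h e
        simpa using this
      · have h1 : ∑ e ∈ Finset.univ.filter (fun e => u ∈ inc e),
            (if h : e ∈ G then v ⟨e, h⟩ else 0)
            = ∑ e : G, (if u ∈ inc (e : E) then v e else 0) := by
          rw [Finset.sum_filter, ← Finset.sum_subset (Finset.subset_univ G)
              (fun e _ he => by simp [he]), ← Finset.sum_attach]
          refine Finset.sum_congr rfl fun e _ => ?_
          simp
        rw [h1]
        by_cases hu : u ∈ U
        · exact hv' ⟨u, hu⟩
        · refine Finset.sum_eq_zero fun e _ => if_neg fun hue => hu ?_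
          exact Finset.mem_filter.2 ⟨Finset.mem_univ _, e, Finset.mem_filter.2 ⟨e.2, hue⟩⟩
    have hneg : ∀ d : E → ℝ, d ≠ 0 →
        (∀ u, ∑ e ∈ Finset.univ.filter (fun e => u ∈ inc e), d e = 0) → ∃ e, d e < 0 := by
      intro d hd hu
      by_contra! hpos
      refine hd (funext fun e => ?_)
      have hne : (inc e).Nonempty := Finset.card_pos.1 (by rw [hk]; omega)
      obtain ⟨u, hue⟩ := hne
      exact (Finset.sum_eq_zero_iff_of_nonneg fun e _ => hpos e).1 (hu u) e (by simp [hue])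
    obtain ⟨d, hd0, hdG, hdu⟩ := main
    have hsupp : ∀ e, x e = 0 → d e = 0 := fun e he =>
      hdG e fun h => (Finset.mem_filter.1 (hGs h)).2 he
    rcases le_total 0 (lpValue c d) with h | h
    · exact ⟨d, hneg d hd0 hdu, hsupp, h, hdu⟩
    · refine ⟨-d, hneg (-d) (neg_ne_zero.2 hd0) fun u => by simp [hdu u], fun e he => by
        simp [hsupp e he], ?_, fun u => by simp [hdu u]⟩
      have : lpValue c (-d) = - lpValue c d := by simp [lpValue]
      linarith
  obtain ⟨d, ⟨e₁, he₁⟩, hd0, hdc, hdu⟩ := hdir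
  -- Ratio test: `e₂` is a first coordinate to reach zero along `d`, so the support shrinks while
  -- feasibility and value are kept.
  obtain ⟨e₂, he₂, hmin⟩ := Finset.exists_min_image (Finset.univ.filter fun e => d e < 0)
    (fun e => x e / (- d e)) ⟨e₁, by simpa using he₁⟩
  have hd2 : d e₂ < 0 := (Finset.mem_filter.1 he₂).2
  set t := x e₂ / (- d e₂) with ht
  have ht0 : 0 ≤ t := div_nonneg (hx.1 _) (by linarith)
  have hfeas : LPFeasible inc (fun e => x e + t * d e) := by
    refine ⟨fun e => ?_, fun u => ?_⟩
    · by_cases h : d e < 0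
      · have := hmin e (by simpa using h)
        rw [le_div_iff₀ (by linarith)] at this
        linarith
      · have := hx.1 e
        have := mul_nonneg ht0 (not_lt.1 h)
        linarith
    · rw [Finset.sum_add_distrib, ← Finset.mul_sum, hdu, mul_zero, add_zero]
      exact hx.2 u
  have hval : lpValue c x ≤ lpValue c (fun e => x e + t * d e) := by
    have : lpValue c (fun e => x e + t * d e) = lpValue c x + t * lpValue c d := by
      simp only [lpValue, Finset.mul_sum, ← Finset.sum_add_distrib]
      exact Finset.sum_congr rfl fun e _ => by ring
    rw [this]
    have := mul_nonneg ht0 hdc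
    linarith
  have hlt : (Finset.univ.filter fun e => x e + t * d e ≠ 0).card < m := by
    rw [← hm]
    refine Finset.card_lt_card (Finset.ssubset_iff_of_subset ?_ |>.2 ⟨e₂, ?_, ?_⟩)
    · intro e he
      simp only [Finset.mem_filter, Finset.mem_univ, true_and] at he ⊢
      intro h0
      exact he (by rw [h0, hd0 e h0]; ring)
    · simp only [Finset.mem_filter, Finset.mem_univ, true_and]
      intro h0; rw [hd0 e₂ h0] at hd2; exact lt_irrefl _ hd2
    · simp only [Finset.mem_filter, Finset.mem_univ, true_and, not_not, ht]
      have : d e₂ ≠ 0 := hd2.ne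
      field_simp; ring
  obtain ⟨x', h1, h2, h3⟩ := ih _ hlt hfeas rfl
  exact ⟨x', h1, hval.trans h2, h3⟩

theorem ratio_inv_pos {k : ℕ} (hk0 : 1 ≤ k) : 0 < (k : ℝ) - 1 + 1 / (k : ℝ) := by
  have : (1 : ℝ) ≤ k := by exact_mod_cast hk0
  have : (0 : ℝ) < 1 / k := by positivity
  linarith

/-- The integrality gap of the matching relaxation of a `k`-uniform hypergraph. -/
theorem LPFeasible.exists_matching [DecidableEq E] {inc : E → Finset V} {k : ℕ} (hk0 : 1 ≤ k)
    (hk : ∀ e, (inc e).card = k) (c : E → ℕ) {x : E → ℝ} (hx : LPFeasible inc x) :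
    ∃ M, IsMatching inc M ∧ ratio k * lpValue c x ≤ (weight c M : ℝ) := by
  obtain ⟨x', hx', hval, hdeg⟩ := hx.exists_sparse hk0 hk c
  have hne : ∀ e, (inc e).Nonempty := fun e => Finset.card_pos.1 (by rw [hk]; omega)
  have hβ := ratio_inv_pos hk0
  have hkpos : (0 : ℝ) < k := by exact_mod_cast hk0
  have hk1 : (1 : ℝ) ≤ k := by exact_mod_cast hk0
  obtain ⟨M, -, hM, hle⟩ := exists_matching_of_peeling inc hne x' hx'.1
    ((k : ℝ) - 1 + 1 / (k : ℝ)) hβ.le (Finset.univ.filter fun e => x' e ≠ 0) (fun G hG hGne => by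
      obtain ⟨v, hvne, hvk⟩ := hdeg G hG hGne
      -- At a vertex `v` of degree at most `k`, the heaviest edge has `x' e ≥ s / k`, where `s` is
      -- the load of `v`. Its neighbourhood weighs at most `s` plus `1 - x' e` for each of the other
      -- `k - 1` vertices, in total at most `k - 1 + s / k`.
      obtain ⟨e, he, hmax⟩ := Finset.exists_max_image _ x' hvne
      obtain ⟨heG, hve⟩ := Finset.mem_filter.1 he
      refine ⟨e, heG, ?_⟩
      set s := ∑ e ∈ G.filter (fun e => v ∈ inc e), x' e with hs
      have hload : ∀ u, ∑ e ∈ G.filter (fun e => u ∈ inc e), x' e ≤ 1 := fun u =>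
        (Finset.sum_le_sum_of_subset_of_nonneg
          (Finset.filter_subset_filter _ (Finset.subset_univ G)) fun i _ _ => hx'.1 i).trans
          (hx'.2 u)
      have hs1 : s ≤ 1 := hload v
      have hsk : s ≤ k * x' e := by
        calc s ≤ (G.filter fun e => v ∈ inc e).card • x' e := Finset.sum_le_card_nsmul _ _ _ hmax
          _ ≤ k * x' e := by
            rw [nsmul_eq_mul]
            exact mul_le_mul_of_nonneg_right (by exact_mod_cast hvk) (hx'.1 e)
      have hcover : ∑ e' ∈ G.filter (fun e' => ¬ Disjoint (inc e') (inc e)), x' e'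
          ≤ s + ∑ u ∈ (inc e).erase v,
            (∑ e' ∈ G.filter (fun e' => u ∈ inc e'), x' e' - x' e) := by
        have hsplit : ∀ u ∈ (inc e).erase v,
            ∑ e' ∈ G.filter (fun e' => u ∈ inc e'), x' e' - x' e
              = ∑ e' ∈ G.erase e, if u ∈ inc e' then x' e' else 0 := fun u hu => by
          rw [Finset.sum_filter, ← Finset.add_sum_erase _ _ heG,
            if_pos (Finset.mem_of_mem_erase hu)]
          ring
        rw [Finset.sum_congr rfl hsplit, Finset.sum_comm, hs, Finset.sum_filter, Finset.sum_filter,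
          ← Finset.add_sum_erase _ _ heG, ← Finset.add_sum_erase _ _ heG, if_pos hve, add_assoc,
          ← Finset.sum_add_distrib]
        have hfst : (if ¬ Disjoint (inc e) (inc e) then x' e else 0) ≤ x' e := by
          split_ifs; exacts [hx'.1 e, le_rfl]
        refine add_le_add hfst (Finset.sum_le_sum fun e' he' => ?_)
        have hnn : ∀ u ∈ (inc e).erase v, 0 ≤ if u ∈ inc e' then x' e' else 0 := fun u _ => by
          split_ifs; exacts [hx'.1 e', le_rfl]
        have hnn' := Finset.sum_nonneg hnn
        by_cases hd : Disjoint (inc e') (inc e)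
        · rw [if_neg (not_not.2 hd)]
          have : 0 ≤ if v ∈ inc e' then x' e' else 0 := by split_ifs; exacts [hx'.1 e', le_rfl]
          linarith
        · rw [if_pos hd]
          by_cases hv : v ∈ inc e'
          · rw [if_pos hv]; linarith
          · obtain ⟨u, hu', hu⟩ := Finset.not_disjoint_iff.1 hd
            have hmem : u ∈ (inc e).erase v :=
              Finset.mem_erase.2 ⟨fun h => hv (h ▸ hu'), hu⟩
            have := Finset.single_le_sum hnn hmem
            rw [if_pos hu'] at this
            rw [if_neg hv]; linarith
      have h2 : ∑ u ∈ (inc e).erase v,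
            (∑ e' ∈ G.filter (fun e' => u ∈ inc e'), x' e' - x' e) ≤ (k - 1) * (1 - x' e) := by
        have := Finset.sum_le_card_nsmul ((inc e).erase v)
          (fun u => ∑ e' ∈ G.filter (fun e' => u ∈ inc e'), x' e' - x' e) (1 - x' e)
          (fun u _ => by linarith [hload u])
        rw [Finset.card_erase_of_mem hve, hk, nsmul_eq_mul, Nat.cast_sub hk0, Nat.cast_one] at this
        exact this
      refine hcover.trans ((add_le_add_right h2 s).trans ?_)
      have hxe : s / k ≤ x' e := by rw [div_le_iff₀ hkpos]; linarith
      have h3 : ((k : ℝ) - 1) * (1 - x' e) ≤ (k - 1) * (1 - s / k) :=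
        mul_le_mul_of_nonneg_left (by linarith) (by linarith)
      have h4 : s + ((k : ℝ) - 1) * (1 - s / k) = k - 1 + s / k := by field_simp; ring
      have h5 : s / k ≤ 1 / k := by gcongr
      linarith) (fun e => (c e : ℝ))
  refine ⟨M, hM, ?_⟩
  have hv : lpValue c x' = ∑ e ∈ Finset.univ.filter (fun e => x' e ≠ 0), (c e : ℝ) * x' e := by
    rw [lpValue, Finset.sum_filter]
    refine Finset.sum_congr rfl fun e _ => ?_
    by_cases h : x' e = 0 <;> simp [h]
  rw [← hv] at hle
  rw [ratio, one_div_mul_eq_div, div_le_iff₀ hβ, weight]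
  push_cast
  linarith

theorem exists_isSolver [DecidableEq E] {inc : E → Finset V} (hne : ∀ e, (inc e).Nonempty) :
    ∃ solve, IsSolver inc solve := by
  choose f hf using exists_lpOptimal hne
  exact ⟨fun _ _ c => f c, fun _ _ c => hf c⟩

theorem exists_isLPRelative [DecidableEq E] {inc : E → Finset V} {k : ℕ} (hk0 : 1 ≤ k)
    (hk : ∀ e, (inc e).card = k) : ∃ round, IsLPRelative inc (ratio k) round := by
  have hne : ∀ e, (inc e).Nonempty := fun e => Finset.card_pos.1 (by rw [hk]; omega)
  choose f hf using exists_lpOptimal hne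
  choose g hg hg' using fun c => (hf c).1.exists_matching hk0 hk c
  refine ⟨fun _ c => g c, fun _ c => ⟨hg c, fun x hx => le_trans ?_ (hg' c)⟩⟩
  exact mul_le_mul_of_nonneg_left ((hf c).2 x hx) (one_div_nonneg.2 (ratio_inv_pos hk0).le)

theorem sparseCover_finite {k : ℕ} (hk0 : 1 ≤ k) {ε : ℝ} (hε : 0 < ε) (μ : ℝ) :
    (sparseCover V k ε μ).Finite := by
  have hδ : 0 < ε / (2 * (k : ℝ)) := by
    have : (0 : ℝ) < k := by exact_mod_cast hk0
    positivity
  let n := ⌈(1 - ε / 2) * μ / (ε / (2 * (k : ℝ)))⌉₊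
  refine (Set.finite_range fun a : V → Fin (n + 1) => fun u =>
    ((a u : ℕ) : ℝ) * (ε / (2 * (k : ℝ)))).subset ?_
  rintro y ⟨hgrid, hsum, -⟩
  choose a ha using hgrid
  have hnn : ∀ u, 0 ≤ y u := fun u => by rw [ha]; positivity
  refine ⟨fun u => ⟨a u, ?_⟩, funext fun u => (ha u).symm⟩
  have h1 : y u ≤ (1 - ε / 2) * μ :=
    (Finset.single_le_sum (f := y) (fun i _ => hnn i) (Finset.mem_univ u)).trans hsum
  rw [ha, ← le_div_iff₀ hδ] at h1
  have : (a u : ℝ) ≤ n := h1.trans (Nat.le_ceil _)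
  exact Nat.lt_succ_of_le (by exact_mod_cast this)

/-- A cheap dual feasible vector bounds the optimum by `(1 - ε) μ`. The grid rounding of an optimal
dual solution then lies in the cover, because `(1 + ε / 2) (1 - ε) ≤ 1 - ε / 2`. -/
theorem isWitnessCover_sparseCover {inc : E → Finset V} {k : ℕ} (hk0 : 1 ≤ k)
    (hk : ∀ e, (inc e).card = k) {ε μ : ℝ} (hε : 0 < ε) (hμ : 0 ≤ μ) :
    IsWitnessCover inc ε (ε / 2) μ (sparseCover V k ε μ) where
  finite := sparseCover_finite hk0 hε μ
  nonneg := by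
    rintro y ⟨hgrid, -, -⟩ u
    obtain ⟨a, ha⟩ := hgrid u
    rw [ha]; positivity
  value_le := fun y hy => hy.2.1
  covers := by
    intro c hc y hy0 hy
    by_contra! hfeas
    have hne : ∀ e, (inc e).Nonempty := fun e => Finset.card_pos.1 (by rw [hk]; omega)
    have hkpos : (0 : ℝ) < k := by exact_mod_cast hk0
    obtain ⟨x, hx⟩ := exists_lpOptimal hne c
    have hval : lpValue c x ≤ (1 - ε) * μ :=
      (lpValue_le_of_dualFeasible hx.1 ⟨hy0, hfeas⟩).trans hy
    obtain ⟨a, ha, hsum, hcard, -⟩ := hx.exists_grid_dualFeasible hk (δ := ε / (2 * k)) (by positivity)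
    have hle : lpValue c x ≤ μ := hval.trans (by nlinarith)
    have hkδ : (k : ℝ) * (ε / (2 * k)) = ε / 2 := by field_simp
    obtain ⟨e, he⟩ := hc (fun u => a u * (ε / (2 * k))) ⟨fun u => ⟨a u, rfl⟩, by
      refine hsum.trans ?_
      rw [hkδ]
      nlinarith, by
      refine le_trans ?_ (mul_le_mul_of_nonneg_left hle hkpos.le)
      refine le_trans ?_ hcard
      rw [suppCard]
      refine Nat.cast_le.2 (Finset.card_le_card fun u hu => ?_)
      simp only [Finset.mem_filter, Finset.mem_univ, true_and] at hu ⊢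
      exact fun h => hu (by simp [h])⟩
    exact absurd (ha.2 e) (not_le.2 he)

theorem exists_dualOptimal_suppCard_lt {inc : E → Finset V} {k : ℕ} (hk0 : 1 ≤ k)
    (hk : ∀ e, (inc e).card = k) {c : E → ℕ} {μ : ℝ} {x : E → ℝ} (hx : LPOptimal inc c x)
    (hμ : lpValue c x < μ) : ∃ y, DualOptimal inc c y ∧ (suppCard y : ℝ) < k * μ := by
  obtain ⟨y, hy, hval⟩ := hx.exists_dualFeasible
  refine ⟨y, hx.dualOptimal_of_le hy hval, (hx.suppCard_le hk hy hval).trans_lt ?_⟩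
  have hkpos : (0 : ℝ) < k := by exact_mod_cast hk0
  gcongr

end Rounding

/-! ### Expectations under discrete laws, with values in `[0, ∞]` so that no summability conditions
arise. -/

section Mean

/-- The expectation of an extended nonnegative function. -/
noncomputable def mean {α : Type*} (P : PMF α) (f : α → ℝ≥0∞) : ℝ≥0∞ := ∑' a, P a * f a

variable {α β : Type*}

theorem expectation_eq_mean (P : PMF α) (f : α → ℕ) :
    expectation P f = mean P fun a => (f a : ℝ≥0∞) := rfl

open Classical in
theorem prob_eq_mean (P : PMF α) (S : Set α) :
    prob P S = mean P fun a => if a ∈ S then 1 else 0 := by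
  rw [prob, PMF.toOuterMeasure_apply]
  exact tsum_congr fun a => by simp [Set.indicator]

theorem mean_pure (a : α) (f : α → ℝ≥0∞) : mean (PMF.pure a) f = f a := by
  classical
  rw [mean, tsum_eq_single a fun b hb => by rw [PMF.pure_apply_of_ne _ _ hb, zero_mul],
    PMF.pure_apply_self, one_mul]

theorem mean_bind (P : PMF α) (q : α → PMF β) (f : β → ℝ≥0∞) :
    mean (P.bind q) f = mean P fun a => mean (q a) f := by
  simp only [mean, PMF.bind_apply, ← ENNReal.tsum_mul_left, ← ENNReal.tsum_mul_right]
  rw [ENNReal.tsum_comm]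
  exact tsum_congr fun a => tsum_congr fun b => mul_assoc _ _ _

theorem mean_map (P : PMF α) (g : α → β) (f : β → ℝ≥0∞) :
    mean (P.map g) f = mean P fun a => f (g a) := by
  rw [← PMF.bind_pure_comp, mean_bind]
  simp only [Function.comp_apply, mean_pure]

theorem mean_mono {P : PMF α} {f g : α → ℝ≥0∞} (h : ∀ a, P a ≠ 0 → f a ≤ g a) :
    mean P f ≤ mean P g :=
  ENNReal.tsum_le_tsum fun a => by
    by_cases h0 : P a = 0
    · simp [h0]
    · exact mul_le_mul_right (h a h0) _

theorem mean_const (P : PMF α) (r : ℝ≥0∞) : (mean P fun _ => r) = r := by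
  rw [mean, ENNReal.tsum_mul_right, P.tsum_coe, one_mul]

theorem mean_le_of_le {P : PMF α} {f : α → ℝ≥0∞} {r : ℝ≥0∞} (h : ∀ a, P a ≠ 0 → f a ≤ r) :
    mean P f ≤ r := (mean_mono h).trans_eq (mean_const P r)

theorem mean_add (P : PMF α) (f g : α → ℝ≥0∞) :
    (mean P fun a => f a + g a) = mean P f + mean P g := by
  simp only [mean, mul_add, ENNReal.tsum_add]

theorem mean_mul_left (P : PMF α) (r : ℝ≥0∞) (f : α → ℝ≥0∞) :
    (mean P fun a => r * f a) = r * mean P f := by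
  simp only [mean, ← ENNReal.tsum_mul_left, mul_left_comm]

theorem mean_sum {ι : Type*} (P : PMF α) (s : Finset ι) (f : ι → α → ℝ≥0∞) :
    (mean P fun a => ∑ i ∈ s, f i a) = ∑ i ∈ s, mean P (f i) := by
  classical
  induction s using Finset.induction_on with
  | empty => simp [mean]
  | insert i s hi ih => simp only [Finset.sum_insert hi, mean_add, ih]

theorem mean_comm (P : PMF α) (Q : PMF β) (f : α → β → ℝ≥0∞) :
    (mean P fun a => mean Q fun b => f a b) = mean Q fun b => mean P fun a => f a b := by
  simp only [mean, ← ENNReal.tsum_mul_left]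
  rw [ENNReal.tsum_comm]
  exact tsum_congr fun b => tsum_congr fun a => mul_left_comm _ _ _

theorem one_sub_le_prob {P : PMF α} {S : Set α} {r : ℝ≥0∞} (h : prob P Sᶜ ≤ r) :
    1 - r ≤ prob P S := by
  classical
  have : prob P S + prob P Sᶜ = 1 := by
    rw [prob_eq_mean, prob_eq_mean, ← mean_add]
    refine Eq.trans ?_ (mean_const P 1)
    congr 1; funext a
    by_cases ha : a ∈ S <;> simp [ha]
  rw [← this]
  exact tsub_le_iff_right.2 (add_le_add_right h _)

end Mean

/-! ### Product laws: factorization, marginals and resampling. -/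

section Product

theorem tsum_pi_prod {E α : Type*} [Fintype E] (f : E → α → ℝ≥0∞) :
    ∑' c : E → α, ∏ e, f e (c e) = ∏ e, ∑' a, f e a := by
  have hfin : ∀ (n : ℕ) (f : Fin n → α → ℝ≥0∞),
      ∑' c : Fin n → α, ∏ e, f e (c e) = ∏ e, ∑' a, f e a := by
    intro n
    induction n with
    | zero => intro f; simp
    | succ n ih =>
      intro f
      rw [← (Fin.consEquiv fun _ : Fin (n + 1) => α).tsum_eq, ENNReal.tsum_prod',
        Fin.prod_univ_succ, ← ih, ← ENNReal.tsum_mul_right]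
      refine tsum_congr fun a => ?_
      rw [← ENNReal.tsum_mul_left]
      refine tsum_congr fun c => ?_
      simp [Fin.consEquiv, Fin.prod_univ_succ]
  let g := Fintype.equivFin E
  rw [← (Equiv.arrowCongr g (Equiv.refl α)).symm.tsum_eq]
  have h1 := hfin _ fun i => f (g.symm i)
  rw [← g.symm.prod_comp fun e => ∑' a, f e a, ← h1]
  refine tsum_congr fun c => ?_
  rw [← g.symm.prod_comp]
  simp

variable {E α : Type*} [Fintype E] [MeasurableSpace α] [MeasurableSingletonClass α] [Countable α]

theorem mean_piPMF_prod (D : E → PMF α) (φ : E → α → ℝ≥0∞) :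
    (mean (piPMF D) fun c => ∏ e, φ e (c e)) = ∏ e, mean (D e) (φ e) := by
  simp only [mean, piPMF_apply, ← Finset.prod_mul_distrib]
  exact tsum_pi_prod fun e a => D e a * φ e a

theorem piPMF_ne_zero {D : E → PMF α} {c : E → α} (h : piPMF D c ≠ 0) (e : E) :
    c e ∈ (D e).support := by
  rw [piPMF_apply, Finset.prod_ne_zero_iff] at h
  exact h e (Finset.mem_univ e)

/-- The weights of the colourful edges are again independent with their old laws, so results on the
adaptive strategy apply to the sparsified hypergraph. -/
theorem piPMF_map_restrict {p : E → Prop} [DecidablePred p] (D : E → PMF α) :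
    (piPMF D).map (fun c (e : {e // p e}) => c e.1) = piPMF fun e : {e // p e} => D e.1 := by
  classical
  ext f
  have h1 : ((piPMF D).map fun c (e : {e // p e}) => c e.1) f
      = mean (piPMF D) fun c => ∏ e, if h : p e then (if c e = f ⟨e, h⟩ then 1 else 0) else 1 := by
    rw [PMF.map_apply]
    refine tsum_congr fun c => ?_
    dsimp only
    split_ifs with h
    · subst h
      rw [Finset.prod_eq_one, mul_one]
      intro e _
      split_ifs <;> simp_all
    · obtain ⟨e, he⟩ := Function.ne_iff.1 h
      rw [Finset.prod_eq_zero (Finset.mem_univ e.1), mul_zero]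
      rw [dif_pos e.2, if_neg (Ne.symm he)]
  rw [h1, mean_piPMF_prod D fun e a => if h : p e then (if a = f ⟨e, h⟩ then 1 else 0) else 1,
    piPMF_apply]
  have h2 : ∀ e, (mean (D e) fun a => if h : p e then (if a = f ⟨e, h⟩ then 1 else 0) else 1)
      = if h : p e then D e (f ⟨e, h⟩) else 1 := by
    intro e
    split_ifs with h
    · simp [mean]
    · exact mean_const _ _
  rw [Finset.prod_congr rfl fun e _ => h2 e,
    ← Finset.prod_subset (Finset.subset_univ (Finset.univ.filter p)) fun e _ he => dif_neg (by
      simpa using he), Finset.prod_subtype (p := p) _ (by simp)]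
  exact Finset.prod_congr rfl fun e _ => dif_pos e.2

variable [DecidableEq E]

/-- Coordinates in `Q` are taken from the first argument, the others from the second one. -/
def mix (Q : Finset E) (c c' : E → α) : E → α := fun e => if e ∈ Q then c e else c' e

/-- Given the coordinates in `Q`, the others can be drawn afresh. -/
theorem mean_resample (D : E → PMF α) (Q : Finset E) (G H : (E → α) → ℝ≥0∞)
    (hG : ∀ c c', (∀ e ∈ Q, c e = c' e) → G c = G c') :
    (mean (piPMF D) fun c => G c * H c)
      = mean (piPMF D) fun c => G c * mean (piPMF D) fun c' => H (mix Q c c') := by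
  have hinv : ∀ c c' : E → α, mix Q (mix Q c c') (mix Q c' c) = c := fun c c' => by
    funext e; simp only [mix]; split_ifs <;> rfl
  -- Exchanging the coordinates outside `Q` between two independent copies is an involution that
  -- preserves the product law.
  let s : (E → α) × (E → α) ≃ (E → α) × (E → α) :=
    ⟨fun q => (mix Q q.1 q.2, mix Q q.2 q.1), fun q => (mix Q q.1 q.2, mix Q q.2 q.1),
      fun q => Prod.ext (hinv _ _) (hinv _ _), fun q => Prod.ext (hinv _ _) (hinv _ _)⟩
  have hP : ∀ c c', piPMF D (mix Q c c') * piPMF D (mix Q c' c) = piPMF D c * piPMF D c' := by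
    intro c c'
    simp only [piPMF_apply, ← Finset.prod_mul_distrib]
    refine Finset.prod_congr rfl fun e _ => ?_
    simp only [mix]; split_ifs
    · rfl
    · exact mul_comm _ _
  have h1 : (mean (piPMF D) fun c => G c * H c)
      = ∑' q : (E → α) × (E → α), piPMF D q.1 * piPMF D q.2 * (G q.1 * H q.1) := by
    rw [ENNReal.tsum_prod']
    refine tsum_congr fun c => ?_
    dsimp only
    rw [ENNReal.tsum_mul_right, ENNReal.tsum_mul_left, PMF.tsum_coe, mul_one]
  rw [h1, ← s.tsum_eq, ENNReal.tsum_prod']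
  refine tsum_congr fun c => ?_
  simp only [mean, ← ENNReal.tsum_mul_left]
  refine tsum_congr fun c' => ?_
  simp only [s, Equiv.coe_fn_mk, hP]
  rw [hG (mix Q c c') c fun e he => by simp [mix, he]]
  ring

end Product

/-! ### Independent random sets of queries. -/

section RandomSubset

variable {E : Type*} [Fintype E] [DecidableEq E]

theorem mean_coin {x : ℝ} (h0 : 0 ≤ x) (h1 : x ≤ 1) (f : Bool → ℝ≥0∞) :
    mean (coin x) f = ENNReal.ofReal x * f true + ENNReal.ofReal (1 - x) * f false := by
  rw [mean, tsum_bool, add_comm]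
  simp [coin, PMF.ofFintype_apply, h0, h1]

theorem mean_randomSubset_prod {x : E → ℝ} (h0 : ∀ e, 0 ≤ x e) (h1 : ∀ e, x e ≤ 1)
    (φ : E → Bool → ℝ≥0∞) :
    (mean (randomSubset x) fun S => ∏ e, φ e (decide (e ∈ S)))
      = ∏ e, (ENNReal.ofReal (x e) * φ e true + ENNReal.ofReal (1 - x e) * φ e false) := by
  rw [randomSubset, mean_map]
  simp only [Finset.mem_filter, Finset.mem_univ, true_and, Bool.decide_eq_true]
  rw [mean_piPMF_prod]
  exact Finset.prod_congr rfl fun e _ => mean_coin (h0 e) (h1 e) _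

theorem mean_randomSubset_mem {x : E → ℝ} (h0 : ∀ e, 0 ≤ x e) (h1 : ∀ e, x e ≤ 1) (e₀ : E) :
    (mean (randomSubset x) fun S => if e₀ ∈ S then 1 else 0) = ENNReal.ofReal (x e₀) := by
  have := mean_randomSubset_prod h0 h1 fun e b => if e = e₀ then (if b then 1 else 0) else 1
  simp only [decide_eq_true_eq, Finset.prod_ite_eq', Finset.mem_univ, if_true] at this
  rw [this, Finset.prod_eq_single e₀]
  · simp
  · intro e _ he
    simp only [if_neg he, mul_one]
    rw [← ENNReal.ofReal_add (h0 e) (sub_nonneg.2 (h1 e))]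
    simp
  · simp

end RandomSubset

/-! ### Survival of a fixed dual vector through the iterations. -/

section Survival

variable {V E : Type*} [Fintype V] [DecidableEq V] [Fintype E] [DecidableEq E]

/-- Since `f ≤ 1` everywhere and `f m ≤ 1 - r`, the mean is at most `1 - p r`. This is the only way
in which the bound `p` on the probability of the maximal weight enters. -/
theorem mean_le_exp {D : PMF ℕ} {m : ℕ} {p r : ℝ} (hp : 0 ≤ p) (hr : 0 ≤ r)
    (hD : ENNReal.ofReal p ≤ D m) {f : ℕ → ℝ≥0∞}
    (hf : ∀ a, f a + (if a = m then ENNReal.ofReal r else 0) ≤ 1) :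
    mean D f ≤ ENNReal.ofReal (Real.exp (-(p * r))) := by
  have hsum : mean D f + (mean D fun a => if a = m then ENNReal.ofReal r else 0) ≤ 1 := by
    rw [← mean_add]
    exact mean_le_of_le fun a _ => hf a
  have hJ : ENNReal.ofReal (p * r) ≤ mean D fun a => if a = m then ENNReal.ofReal r else 0 := by
    refine le_trans ?_ (ENNReal.le_tsum m)
    dsimp only
    rw [if_pos rfl, ENNReal.ofReal_mul hp]
    exact mul_le_mul_left hD _
  have hle : mean D f ≤ 1 - ENNReal.ofReal (p * r) :=
    ENNReal.le_sub_of_add_le_right ENNReal.ofReal_ne_top ((add_le_add_right hJ _).trans hsum)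
  refine hle.trans ?_
  rw [← ENNReal.ofReal_one, ← ENNReal.ofReal_sub _ (mul_nonneg hp hr)]
  refine ENNReal.ofReal_le_ofReal ?_
  have := Real.add_one_le_exp (-(p * r))
  linarith

/-- The probability that querying a random set of edges finds no unqueried edge whose weight
exceeds its threshold. -/
theorem mean_survive_le {cm cp : E → ℕ} {p : ℝ} (hp : 0 ≤ p) {D : E → PMF ℕ}
    (hD : AdmissibleLaw cm cp p D) {x : E → ℝ} (h0 : ∀ e, 0 ≤ x e) (h1 : ∀ e, x e ≤ 1)
    (Q : Finset E) (Y : E → ℝ) :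
    (mean (piPMF D) fun c => mean (randomSubset x) fun S =>
        if ∀ e ∈ S, e ∉ Q → (c e : ℝ) ≤ Y e then 1 else 0)
      ≤ ENNReal.ofReal (Real.exp (-(p *
          ∑ e ∈ Finset.univ.filter (fun e => e ∉ Q ∧ Y e < cp e), x e))) := by
  let I : E → ℕ → ℝ≥0∞ := fun e a => if e ∉ Q ∧ Y e < (a : ℝ) then 0 else 1
  have hinner : ∀ c : E → ℕ, (mean (randomSubset x) fun S =>
      if ∀ e ∈ S, e ∉ Q → (c e : ℝ) ≤ Y e then (1 : ℝ≥0∞) else 0)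
      = ∏ e, (ENNReal.ofReal (x e) * I e (c e) + ENNReal.ofReal (1 - x e)) := by
    intro c
    have := mean_randomSubset_prod h0 h1 fun e b => if b then I e (c e) else 1
    simp only [decide_eq_true_eq, if_true, mul_one, Bool.false_eq_true, if_false] at this
    rw [← this]
    congr 1; funext S
    split_ifs with h
    · rw [Finset.prod_eq_one]
      intro e _
      split_ifs with he
      · exact if_neg fun h' => absurd (h e he h'.1) (not_le.2 h'.2)
      · rfl
    · push Not at h
      obtain ⟨e, he, heQ, hlt⟩ := h
      rw [Finset.prod_eq_zero (Finset.mem_univ e)]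
      rw [if_pos he]; exact if_pos ⟨heQ, hlt⟩
  simp only [hinner]
  rw [mean_piPMF_prod D fun e a => ENNReal.ofReal (x e) * I e a + ENNReal.ofReal (1 - x e)]
  have hone : ∀ e, ENNReal.ofReal (x e) + ENNReal.ofReal (1 - x e) = 1 := fun e => by
    rw [← ENNReal.ofReal_add (h0 e) (sub_nonneg.2 (h1 e))]; simp
  have hfac : ∀ e, (mean (D e) fun a => ENNReal.ofReal (x e) * I e a + ENNReal.ofReal (1 - x e))
      ≤ ENNReal.ofReal (Real.exp (-(if e ∉ Q ∧ Y e < cp e then p * x e else 0))) := by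
    intro e
    by_cases he : e ∉ Q ∧ Y e < cp e
    · rw [if_pos he]
      refine mean_le_exp hp (h0 e) (hD e).2 fun a => ?_
      rcases eq_or_ne a (cp e) with rfl | ha
      · simp only [I, if_pos he, mul_zero, zero_add, if_true, add_comm, hone e, le_refl]
      · rw [if_neg ha, add_zero]
        refine (add_le_add_left ?_ _).trans_eq (hone e)
        exact mul_le_of_le_one_right' (by simp only [I]; split_ifs <;> simp)
    · rw [if_neg he, neg_zero, Real.exp_zero, ENNReal.ofReal_one]
      refine mean_le_of_le fun a _ => (add_le_add_left ?_ _).trans_eq (hone e)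
      exact mul_le_of_le_one_right' (by simp only [I]; split_ifs <;> simp)
  refine (Finset.prod_le_prod' fun e _ => hfac e).trans_eq ?_
  rw [← ENNReal.ofReal_prod_of_nonneg fun e _ => (Real.exp_pos _).le, ← Real.exp_sum,
    Finset.sum_neg_distrib, Finset.mul_sum, Finset.sum_filter]

theorem optimistic_congr {cp : E → ℕ} {Q : Finset E} {c c' : E → ℕ} (h : ∀ e ∈ Q, c e = c' e) :
    optimistic cp Q c = optimistic cp Q c' := by
  funext e; simp only [optimistic]; split_ifs with he; exacts [h e he, rfl]

theorem pessimistic_congr {cm : E → ℕ} {Q : Finset E} {c c' : E → ℕ} (h : ∀ e ∈ Q, c e = c' e) :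
    pessimistic cm Q c = pessimistic cm Q c' := by
  funext e; simp only [pessimistic]; split_ifs with he; exacts [h e he, rfl]

/-- The probability that `Q` is queried depends on the weights of the edges in `Q` only. -/
theorem queryLaw_congr (cp : E → ℕ) (solve : Solver E) (t : ℕ) {Q : Finset E} {c c' : E → ℕ}
    (h : ∀ e ∈ Q, c e = c' e) : queryLaw cp solve c t Q = queryLaw cp solve c' t Q := by
  induction t generalizing Q with
  | zero => rfl
  | succ t ih =>
    simp only [queryLaw, PMF.bind_apply]
    refine tsum_congr fun Q' => ?_
    -- Query sets only grow, so an earlier set that is not contained in `Q` cannot lead to `Q`.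
    by_cases hQ : Q' ⊆ Q
    · rw [ih fun e he => h e (hQ he), optimistic_congr fun e he => h e (hQ he)]
    · have : ∀ x : E → ℝ, ((randomSubset x).map fun S => Q' ∪ S) Q = 0 := fun x => by
        rw [PMF.apply_eq_zero_iff, PMF.mem_support_map_iff]
        rintro ⟨S, -, rfl⟩
        exact hQ Finset.subset_union_left
      rw [this, this, mul_zero, mul_zero]

/-- The vector `y` is still feasible for the pessimistic dual, while the optimistic value is still
at least `μ`. -/
def Alive (inc : E → Finset V) (cm cp : E → ℕ) (y : V → ℝ) (μ : ℝ) (Q : Finset E) (c : E → ℕ) :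
    Prop :=
  DualFeasible inc (pessimistic cm Q c) y ∧ ∃ x, LPFeasible inc x ∧ μ ≤ lpValue (optimistic cp Q c) x

theorem Alive.of_union {inc : E → Finset V} {cm cp : E → ℕ} {y : V → ℝ} {μ : ℝ} {Q S : Finset E}
    {c : E → ℕ} (h : Alive inc cm cp y μ (Q ∪ S) c) (hcm : ∀ e, cm e ≤ c e)
    (hcp : ∀ e, c e ≤ cp e) :
    Alive inc cm cp y μ Q c ∧ ∀ e ∈ S, e ∉ Q → (c e : ℝ) ≤ ∑ u ∈ inc e, y u := by
  obtain ⟨⟨hy, hfe⟩, x, hx, hμ⟩ := h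
  refine ⟨⟨⟨hy, fun e => le_trans ?_ (hfe e)⟩, x, hx, hμ.trans (lpValue_mono (fun e => ?_) hx.1)⟩,
    fun e he _ => ?_⟩
  · simp only [pessimistic, Finset.mem_union]
    have := hcm e
    split_ifs <;> simp_all
  · simp only [optimistic, Finset.mem_union]
    have := hcp e
    split_ifs <;> simp_all
  · have := hfe e
    rwa [pessimistic, if_pos (Finset.mem_union_right _ he)] at this

open Classical in
/-- The probability that a given dual vector survives `t` iterations. -/
theorem mean_alive_le {inc : E → Finset V} (hne : ∀ e, (inc e).Nonempty) {cm cp : E → ℕ} {p : ℝ}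
    (hp : 0 ≤ p) {D : E → PMF ℕ} (hD : AdmissibleLaw cm cp p D) {solve : Solver E}
    (hs : IsSolver inc solve) {Δ : ℝ} (hΔ : 0 < Δ) (hgap : ∀ e, (cp e : ℝ) - cm e ≤ Δ)
    {y : V → ℝ} {μ η : ℝ} (hμ : ∑ u, y u + η ≤ μ) (t : ℕ) :
    (mean (piPMF D) fun c => mean (queryLaw cp solve c t) fun Q =>
        if Alive inc cm cp y μ Q c then 1 else 0)
      ≤ ENNReal.ofReal (Real.exp (-(p * (η / Δ)))) ^ t := by
  induction t with
  | zero =>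
    rw [pow_zero]
    exact mean_le_of_le fun c _ => mean_le_of_le fun Q _ => by split_ifs <;> simp
  | succ t ih =>
  let g : Finset E → (E → ℕ) → ℝ≥0∞ := fun Q c => if Alive inc cm cp y μ Q c then 1 else 0
  let Y : E → ℝ := fun e => ∑ u ∈ inc e, y u
  let X : Finset E → (E → ℕ) → E → ℝ := fun Q c => solve t Q (optimistic cp Q c)
  let h : Finset E → (E → ℕ) → ℝ≥0∞ := fun Q c =>
    mean (randomSubset (X Q c)) fun S => if ∀ e ∈ S, e ∉ Q → (c e : ℝ) ≤ Y e then 1 else 0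
  -- To survive iteration `t + 1`, the vector must be alive before it, and no newly queried edge may
  -- exceed its price.
  have hstep : (mean (piPMF D) fun c => mean (queryLaw cp solve c (t + 1)) fun Q => g Q c)
      ≤ mean (piPMF D) fun c => mean (queryLaw cp solve c t) fun Q => g Q c * h Q c := by
    refine mean_mono fun c hc => ?_
    have hcs := fun e => (hD e).1 _ (piPMF_ne_zero hc e)
    rw [queryLaw, mean_bind]
    refine mean_mono fun Q _ => ?_
    rw [mean_map]
    simp only [h]
    rw [← mean_mul_left]
    refine mean_mono fun S _ => ?_
    by_cases hA : Alive inc cm cp y μ (Q ∪ S) c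
    · obtain ⟨h1, h2⟩ := hA.of_union (fun e => (hcs e).1) (fun e => (hcs e).2)
      simp only [g, if_pos hA, if_pos h1]
      rw [if_pos h2, one_mul]
    · simp only [g, if_neg hA, zero_le]
  refine hstep.trans ?_
  -- The law of `Q` depends on `c`, so the two means cannot simply be exchanged. Summing over `Q`
  -- outermost fixes it, after which the weights outside `Q` can be redrawn.
  have hswap : ∀ F : Finset E → (E → ℕ) → ℝ≥0∞,
      (mean (piPMF D) fun c => mean (queryLaw cp solve c t) fun Q => F Q c)
        = ∑' Q, mean (piPMF D) fun c => queryLaw cp solve c t Q * F Q c := by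
    intro F
    simp only [mean, ← ENNReal.tsum_mul_left]
    exact ENNReal.tsum_comm
  rw [hswap, pow_succ]
  refine le_trans ?_ (mul_le_mul_left ih _)
  rw [hswap fun Q c => g Q c, ← ENNReal.tsum_mul_right]
  refine ENNReal.tsum_le_tsum fun Q => ?_
  have hgQ : ∀ c c' : E → ℕ, (∀ e ∈ Q, c e = c' e) → g Q c = g Q c' := fun c c' hcc => by
    refine if_congr ?_ rfl rfl
    rw [Alive, Alive, optimistic_congr hcc, pessimistic_congr hcc]
  have hres := mean_resample D Q (fun c => queryLaw cp solve c t Q * g Q c) (h Q)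
    fun c c' hcc => by rw [queryLaw_congr cp solve t hcc, hgQ c c' hcc]
  simp only [mul_assoc] at hres
  rw [hres, mul_comm, ← mean_mul_left]
  refine mean_mono fun c _ => ?_
  rw [mul_comm _ (queryLaw cp solve c t Q * g Q c), mul_assoc]
  refine mul_le_mul_right ?_ _
  by_cases hA : Alive inc cm cp y μ Q c
  swap
  · simp only [g, if_neg hA, zero_mul, le_refl]
  refine mul_le_mul_right ?_ _
  have hX : ∀ c', X Q (mix Q c c') = X Q c := fun c' => by
    simp only [X]
    rw [optimistic_congr (c := mix Q c c') (c' := c) fun e he => by simp [mix, he]]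
  have hmix : ∀ c' : E → ℕ, h Q (mix Q c c') = mean (randomSubset (X Q c)) fun S =>
      if ∀ e ∈ S, e ∉ Q → (c' e : ℝ) ≤ Y e then 1 else 0 := by
    intro c'
    simp only [h, hX]
    congr 1; funext S
    refine if_congr (forall₂_congr fun e _ => forall_congr' fun heQ => ?_) rfl rfl
    simp [mix, heQ]
  simp only [hmix]
  have hopt := hs t Q (optimistic cp Q c)
  have hle1 := hopt.1.le_one hne
  refine (mean_survive_le hp hD hopt.1.1 hle1 Q Y).trans ?_
  refine ENNReal.ofReal_le_ofReal (Real.exp_le_exp.2 (neg_le_neg ?_))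
  refine mul_le_mul_of_nonneg_left ?_ hp
  rw [div_le_iff₀ hΔ]
  obtain ⟨hfeas, x', hx', hμ'⟩ := hA
  have h1 := hμ'.trans (hopt.2 x' hx')
  have h2 := hopt.1.sum_edge_mul_le hfeas.1
  -- Queried edges contribute nothing positive since `y` already covers their realized weight. Of
  -- the others only those with `Y e < cp e` do, and their excess is at most `cp e - cm e ≤ Δ`,
  -- because `y` covers `cm e`.
  have h3 : lpValue (optimistic cp Q c) (X Q c) - ∑ e, Y e * X Q c e
      ≤ ∑ e ∈ Finset.univ.filter (fun e => e ∉ Q ∧ Y e < cp e), X Q c e * Δ := by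
    rw [lpValue, ← Finset.sum_sub_distrib, Finset.sum_filter]
    refine Finset.sum_le_sum fun e _ => ?_
    rw [← sub_mul]
    have hx0 : 0 ≤ X Q c e := hopt.1.1 e
    have hfe : ((pessimistic cm Q c e : ℕ) : ℝ) ≤ Y e := hfeas.2 e
    by_cases he : e ∈ Q
    · rw [if_neg (by simp [he])]
      simp only [pessimistic, if_pos he] at hfe
      simp only [optimistic, if_pos he]
      exact mul_nonpos_of_nonpos_of_nonneg (by linarith) hx0
    · simp only [pessimistic, if_neg he] at hfe
      simp only [optimistic, if_neg he]
      have := hgap e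
      split_ifs with hlt
      · rw [mul_comm]
        exact mul_le_mul_of_nonneg_left (by linarith) hx0
      · have : (cp e : ℝ) ≤ Y e := by
          by_contra! h'
          exact hlt ⟨he, h'⟩
        exact mul_nonpos_of_nonpos_of_nonneg (by linarith) hx0
  rw [← Finset.sum_mul] at h3
  change μ ≤ lpValue (optimistic cp Q c) (X Q c) at h1
  change ∑ e, Y e * X Q c e ≤ ∑ u, y u at h2
  change η ≤ (∑ e ∈ Finset.univ.filter (fun e => e ∉ Q ∧ Y e < cp e), X Q c e) * Δ
  linarith

end Survival

/-! ### Union bound over grid vectors. -/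

section UnionBound

/-- The full geometric series equals `1 / (exp z - 1)`, and `exp z ≥ 1 + z`. -/
theorem sum_range_exp_le {z : ℝ} (hz : 0 < z) (n : ℕ) :
    ∑ i ∈ Finset.range n, Real.exp (-z) ^ (i + 1) ≤ 1 / z := by
  set r := Real.exp (-z) with hr
  have hr0 : 0 < r := Real.exp_pos _
  have hr1 : (z + 1) * r ≤ 1 := by
    calc (z + 1) * r ≤ Real.exp z * r := mul_le_mul_of_nonneg_right (Real.add_one_le_exp z) hr0.le
      _ = 1 := by rw [hr, ← Real.exp_add, add_neg_cancel, Real.exp_zero]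
  have hgeom := geom_sum_mul_neg r n
  have hpow : 0 ≤ r ^ n := by positivity
  have hs : 0 ≤ ∑ i ∈ Finset.range n, r ^ i := Finset.sum_nonneg fun i _ => by positivity
  simp only [pow_succ, ← Finset.sum_mul]
  rw [le_div_iff₀ hz]
  nlinarith

/-- The generating function of the grid vectors, weighted by their sum and their support. -/
theorem sum_grid_le {V : Type*} [Fintype V] [DecidableEq V] {q z : ℝ} (hq : 0 ≤ q) (hz : 0 < z)
    (A : ℕ) : ∑ a ∈ Fintype.piFinset (fun _ : V => Finset.range (A + 1)),
      ∏ u, (if a u = 0 then 1 else q * Real.exp (-z) ^ a u)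
      ≤ Real.exp (Fintype.card V * (q * (1 / z))) := by
  rw [← Finset.prod_univ_sum (fun _ : V => Finset.range (A + 1))
    (fun (_ : V) i => if i = 0 then (1 : ℝ) else q * Real.exp (-z) ^ i)]
  rw [Finset.prod_const, Finset.card_univ, Real.exp_nat_mul]
  refine pow_le_pow_left₀ (Finset.sum_nonneg fun i _ => by split_ifs <;> positivity) ?_ _
  rw [Finset.sum_range_succ']
  simp only [Nat.add_eq_zero_iff, one_ne_zero, and_false, if_false, if_true, ← Finset.mul_sum]
  have := mul_le_mul_of_nonneg_left (sum_range_exp_le hz A) hq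
  have := Real.add_one_le_exp (q * (1 / z))
  linarith

variable {V E : Type*} [Fintype V] [DecidableEq V] [Fintype E] [DecidableEq E]

/-- The realized optimum is at least `μ₀`, but the pessimistic optimum is smaller by more than a
factor `1 - ε`. -/
def Fails (inc : E → Finset V) (cm : E → ℕ) (ε μ₀ : ℝ) (Q : Finset E) (c : E → ℕ) : Prop :=
  ∃ x, LPFeasible inc x ∧ μ₀ ≤ lpValue c x ∧
    ∀ x', LPFeasible inc x' → lpValue (pessimistic cm Q c) x' < (1 - ε) * lpValue c x

/-- The witness is the rounded optimal dual solution of the pessimistic relaxation. The threshold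
depends on the vector alone, not on the unknown optimum; the range of the entries only makes the
union bound finite. -/
theorem Fails.exists_alive {inc : E → Finset V} {k : ℕ} (hk0 : 1 ≤ k)
    (hk : ∀ e, (inc e).card = k) {cm cp : E → ℕ} {ε μ₀ : ℝ} (hε : 0 < ε) (hε1 : ε < 1)
    {Q : Finset E} {c : E → ℕ} (hcp : ∀ e, c e ≤ cp e) (h : Fails inc cm ε μ₀ Q c) :
    ∃ a ∈ Fintype.piFinset
        (fun _ : V => Finset.range (⌈(∑ e, (cp e : ℝ)) / (ε / (2 * k))⌉₊ + 1)),
      ((Finset.univ.filter fun u => a u ≠ 0).card : ℝ) ≤ k * ∑ u, (a u : ℝ) * (ε / (2 * k)) ∧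
      Alive inc cm cp (fun u => a u * (ε / (2 * k)))
        (max μ₀ ((∑ u, (a u : ℝ) * (ε / (2 * k))) / (1 - ε / 2))) Q c := by
  obtain ⟨x, hx, hμ, hlt⟩ := h
  have hne : ∀ e, (inc e).Nonempty := fun e => Finset.card_pos.1 (by rw [hk]; omega)
  have hkpos : (0 : ℝ) < k := by exact_mod_cast hk0
  have hδ : 0 < ε / (2 * (k : ℝ)) := by positivity
  have hkδ : (k : ℝ) * (ε / (2 * k)) = ε / 2 := by field_simp
  obtain ⟨z, hz⟩ := exists_lpOptimal hne (pessimistic cm Q c)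
  obtain ⟨a, ha, hsum, -, hcard⟩ := hz.exists_grid_dualFeasible hk hδ
  rw [hkδ] at hsum
  have hL : 0 ≤ lpValue c x := lpValue_nonneg c hx.1
  have hzlt := hlt z hz.1
  have hsumL : ∑ u, (a u : ℝ) * (ε / (2 * k)) ≤ (1 - ε / 2) * lpValue c x := by
    refine hsum.trans ?_
    have : (1 + ε / 2) * lpValue (pessimistic cm Q c) z ≤ (1 + ε / 2) * ((1 - ε) * lpValue c x) :=
      mul_le_mul_of_nonneg_left hzlt.le (by linarith)
    nlinarith [mul_nonneg (sq_nonneg ε) hL]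
  have hLcp : lpValue c x ≤ ∑ e, (cp e : ℝ) := Finset.sum_le_sum fun e _ => by
    have h1 := hx.le_one hne e
    have h2 : (c e : ℝ) ≤ cp e := by exact_mod_cast hcp e
    exact (mul_le_of_le_one_right (Nat.cast_nonneg _) h1).trans h2
  refine ⟨a, Fintype.mem_piFinset.2 fun u => ?_, hcard, ha, x, hx, ?_⟩
  · rw [Finset.mem_range, Nat.lt_succ_iff]
    have h1 : (a u : ℝ) * (ε / (2 * k)) ≤ ∑ e, (cp e : ℝ) := by
      refine le_trans (Finset.single_le_sum (f := fun u => (a u : ℝ) * (ε / (2 * k)))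
        (fun i _ => by positivity) (Finset.mem_univ u)) (hsumL.trans (le_trans ?_ hLcp))
      nlinarith
    rw [← le_div_iff₀ hδ] at h1
    exact_mod_cast h1.trans (Nat.le_ceil _)
  · refine le_trans (max_le hμ ?_) (lpValue_mono (fun e => ?_) hx.1)
    · rw [div_le_iff₀ (by linarith)]; linarith
    · simp only [optimistic]; split_ifs; exacts [le_rfl, hcp e]

open Classical in
/-- With high probability the pessimistic optimum is close to the realized optimum. -/
theorem mean_fails_le {inc : E → Finset V} {k : ℕ} (hk0 : 1 ≤ k)
    (hk : ∀ e, (inc e).card = k) {cm cp : E → ℕ} {p : ℝ} (hp : 0 ≤ p) {D : E → PMF ℕ}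
    (hD : AdmissibleLaw cm cp p D) {solve : Solver E} (hs : IsSolver inc solve) {Δ : ℝ}
    (hΔ : 0 < Δ) (hgap : ∀ e, (cp e : ℝ) - cm e ≤ Δ) {ε μ₀ b : ℝ} (hε : 0 < ε) (hε1 : ε < 1)
    (hμ₀ : 0 ≤ μ₀) (hb : 0 < b) {T : ℕ} (hT : b ≤ T * (p * (ε / 2 / Δ))) :
    (mean (piPMF D) fun c => mean (queryLaw cp solve c T) fun Q =>
        if Fails inc cm ε μ₀ Q c then 1 else 0)
      ≤ ENNReal.ofReal (Real.exp (-(b * μ₀ / 2) +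
          Fintype.card V * (Real.exp (-(b / (4 * k))) * (8 * k / (b * ε))))) := by
  have hne : ∀ e, (inc e).Nonempty := fun e => Finset.card_pos.1 (by rw [hk]; omega)
  have hkpos : (0 : ℝ) < k := by exact_mod_cast hk0
  set δ := ε / (2 * (k : ℝ)) with hδdef
  have hδ : 0 < δ := by positivity
  set A := ⌈(∑ e, (cp e : ℝ)) / δ⌉₊
  let grid : Finset (V → ℕ) := (Fintype.piFinset fun _ : V => Finset.range (A + 1)).filter
    fun a => ((Finset.univ.filter fun u => a u ≠ 0).card : ℝ) ≤ k * ∑ u, (a u : ℝ) * δ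
  let μ : (V → ℕ) → ℝ := fun a => max μ₀ ((∑ u, (a u : ℝ) * δ) / (1 - ε / 2))
  have hμ0 : ∀ a, 0 ≤ μ a := fun a => hμ₀.trans (le_max_left _ _)
  have hunion : (mean (piPMF D) fun c => mean (queryLaw cp solve c T) fun Q =>
        if Fails inc cm ε μ₀ Q c then (1 : ℝ≥0∞) else 0)
      ≤ ∑ a ∈ grid, mean (piPMF D) fun c => mean (queryLaw cp solve c T) fun Q =>
        if Alive inc cm cp (fun u => a u * δ) (μ a) Q c then 1 else 0 := by
    rw [← mean_sum]
    refine mean_mono fun c hc => ?_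
    have hcs := fun e => (hD e).1 _ (piPMF_ne_zero hc e)
    rw [← mean_sum]
    refine mean_mono fun Q _ => ?_
    split_ifs with hF
    · obtain ⟨a, ha, hcard, hal⟩ := hF.exists_alive hk0 hk hε hε1 fun e => (hcs e).2
      refine le_trans (by rw [if_pos hal]) (Finset.single_le_sum
        (f := fun a : V → ℕ =>
          if Alive inc cm cp (fun u => a u * δ) (μ a) Q c then (1 : ℝ≥0∞) else 0)
        (fun _ _ => zero_le) (Finset.mem_filter.2 ⟨ha, hcard⟩))
    · exact zero_le
  refine hunion.trans ?_
  have hterm : ∀ a ∈ grid, (mean (piPMF D) fun c => mean (queryLaw cp solve c T) fun Q =>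
        if Alive inc cm cp (fun u => a u * δ) (μ a) Q c then (1 : ℝ≥0∞) else 0)
      ≤ ENNReal.ofReal (Real.exp (-(b * μ₀ / 2)) * ∏ u, (if a u = 0 then 1 else
          Real.exp (-(b / (4 * k))) * Real.exp (-(b * δ / 4)) ^ a u)) := by
    intro a ha
    have hcard := (Finset.mem_filter.1 ha).2
    have hsum : ∑ u, (a u : ℝ) * δ + ε / 2 * μ a ≤ μ a := by
      have h1 : (∑ u, (a u : ℝ) * δ) / (1 - ε / 2) ≤ μ a := le_max_right _ _
      rw [div_le_iff₀ (by linarith)] at h1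
      linarith
    refine (mean_alive_le hne hp hD hs hΔ hgap hsum T).trans ?_
    rw [← ENNReal.ofReal_pow (Real.exp_pos _).le, ← Real.exp_nat_mul]
    refine ENNReal.ofReal_le_ofReal ?_
    have hprod : ∏ u, (if a u = 0 then 1 else
          Real.exp (-(b / (4 * k))) * Real.exp (-(b * δ / 4)) ^ a u)
        = Real.exp (∑ u, (-(b * δ / 4) * a u + if a u ≠ 0 then -(b / (4 * k)) else 0)) := by
      rw [Real.exp_sum]
      refine Finset.prod_congr rfl fun u _ => ?_
      by_cases h0 : a u = 0
      · simp [h0]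
      · rw [if_neg h0, if_pos h0, Real.exp_add, mul_comm, mul_comm _ (a u : ℝ), Real.exp_nat_mul]
    rw [hprod, ← Real.exp_add, Finset.sum_add_distrib, ← Finset.mul_sum, ← Finset.sum_filter,
      Finset.sum_const, nsmul_eq_mul]
    refine Real.exp_le_exp.2 ?_
    have h1 : (T : ℝ) * -(p * (ε / 2 * μ a / Δ)) ≤ - (b * μ a) := by
      have := mul_le_mul_of_nonneg_right hT (hμ0 a)
      have h2 : (T : ℝ) * (p * (ε / 2 / Δ)) * μ a = T * (p * (ε / 2 * μ a / Δ)) := by ring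
      linarith
    refine h1.trans ?_
    set S := ∑ u, (a u : ℝ) * δ with hS
    have hS0 : 0 ≤ S := Finset.sum_nonneg fun u _ => by positivity
    -- Of the decay `exp (-b μ a)`, one half of `μ₀` is kept as a global factor. Of the half of `S`,
    -- one quarter pays for the grid values and the other, through `hcard`, for the support size.
    have hμS : μ₀ / 2 + S / 2 ≤ μ a := by
      have h2 : μ₀ ≤ μ a := le_max_left _ _
      have h3 : ε / 2 * μ a ≥ 0 := mul_nonneg (by linarith) (hμ0 a)
      linarith
    set s := ((Finset.univ.filter fun u => a u ≠ 0).card : ℝ)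
    have hs4 : s * (b / (4 * k)) ≤ b * S / 4 := by
      have : s * (b / (4 * k)) ≤ k * S * (b / (4 * k)) :=
        mul_le_mul_of_nonneg_right hcard (by positivity)
      refine this.trans_eq ?_
      field_simp
    have hSa : b * δ / 4 * ∑ u, (a u : ℝ) = b * S / 4 := by
      rw [hS, ← Finset.sum_mul]; ring
    have := mul_le_mul_of_nonneg_left hμS hb.le
    linarith
  refine (Finset.sum_le_sum hterm).trans ?_
  have hnn : ∀ a : V → ℕ, 0 ≤ ∏ u, (if a u = 0 then 1 else
          Real.exp (-(b / (4 * k))) * Real.exp (-(b * δ / 4)) ^ a u) := fun a =>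
    Finset.prod_nonneg fun u _ => by split_ifs <;> positivity
  rw [← ENNReal.ofReal_sum_of_nonneg fun a _ => mul_nonneg (Real.exp_pos _).le (hnn a),
    ← Finset.mul_sum, Real.exp_add]
  refine ENNReal.ofReal_le_ofReal (mul_le_mul_of_nonneg_left ?_ (Real.exp_pos _).le)
  refine (Finset.sum_le_sum_of_subset_of_nonneg (Finset.filter_subset _ _)
    fun a _ _ => hnn a).trans ?_
  refine (sum_grid_le (Real.exp_pos _).le (by positivity) A).trans_eq ?_
  congr 3
  rw [hδdef]; field_simp; norm_num

end UnionBound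

/-! ### The guarantee of the adaptive strategy. -/

section Adaptive

variable {V E : Type*} [Fintype V] [DecidableEq V] [Fintype E] [DecidableEq E]

theorem IsMatching.lpFeasible {inc : E → Finset V} {M : Finset E} (hM : IsMatching inc M) :
    LPFeasible inc (fun e => if e ∈ M then 1 else 0) := by
  refine ⟨fun e => by dsimp only; split_ifs <;> norm_num, fun u => ?_⟩
  rw [Finset.sum_boole, Finset.filter_filter]
  have : (Finset.univ.filter fun e => u ∈ inc e ∧ e ∈ M) = M.filter fun e => u ∈ inc e := by
    ext e; simp [and_comm]
  rw [this]
  exact_mod_cast hM u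

theorem lpValue_indicator (c : E → ℕ) (M : Finset E) :
    lpValue c (fun e => if e ∈ M then 1 else 0) = weight c M := by
  simp [lpValue, weight]

theorem weight_pessimistic_le {cm : E → ℕ} {Q : Finset E} {c : E → ℕ} (hcm : ∀ e, cm e ≤ c e)
    (M : Finset E) : weight (pessimistic cm Q c) M ≤ weight c M :=
  Finset.sum_le_sum fun e _ => by
    simp only [pessimistic]; split_ifs; exacts [le_rfl, hcm e]

/-- The threshold `1` suffices because weights are integers: a matching of nonzero weight has weight
at least `1`, and for weight zero there is nothing to prove. -/
theorem IsLPRelative.isApproxMatching {inc : E → Finset V} {k : ℕ} (hk0 : 1 ≤ k)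
    {round : Rounding E} (hr : IsLPRelative inc (ratio k) round) {cm : E → ℕ} {Q : Finset E}
    {c : E → ℕ} (hcm : ∀ e, cm e ≤ c e) {ε : ℝ} (h : ¬ Fails inc cm ε 1 Q c) :
    IsApproxMatching inc c ((1 - ε) / ((k : ℝ) - 1 + 1 / (k : ℝ)))
      (round Q (pessimistic cm Q c)) := by
  refine ⟨(hr Q _).1, fun M' hM' => ?_⟩
  rcases Nat.eq_zero_or_pos (weight c M') with h0 | hpos
  · rw [h0]; simp
  by_contra! hlt
  refine h ⟨_, hM'.lpFeasible, ?_, fun x' hx' => ?_⟩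
  · rw [lpValue_indicator]; exact_mod_cast hpos
  · rw [lpValue_indicator]
    have h1 := (hr Q (pessimistic cm Q c)).2 x' hx'
    have h2 : ((weight (pessimistic cm Q c) (round Q (pessimistic cm Q c)) : ℕ) : ℝ)
        ≤ weight c (round Q (pessimistic cm Q c)) := Nat.cast_le.2 (weight_pessimistic_le hcm _)
    have h3 := (h1.trans h2).trans_lt hlt
    have hβ := ratio_inv_pos hk0
    rw [ratio, one_div_mul_eq_div, div_mul_eq_mul_div, div_lt_div_iff_of_pos_right hβ] at h3
    exact h3

theorem ofReal_one_sub_le_prob {α : Type*} {P : PMF α} {S : Set α} {ε : ℝ} (hε : 0 ≤ ε)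
    (h : prob P Sᶜ ≤ ENNReal.ofReal ε) : ENNReal.ofReal (1 - ε) ≤ prob P S := by
  rw [ENNReal.ofReal_sub _ hε, ENNReal.ofReal_one]
  exact one_sub_le_prob h

theorem exp_neg_div_le {ε a : ℝ} (hε : 0 < ε) (ha : 0 < a) : Real.exp (-(a / ε)) ≤ ε / a := by
  rw [Real.exp_neg, inv_le_comm₀ (Real.exp_pos _) (by positivity), inv_div]
  have := Real.add_one_le_exp (a / ε)
  linarith

theorem failure_exponent_le {k n : ℕ} {ε b : ℝ} (hk0 : 1 ≤ k) (hkn : k ≤ n) (hε : 0 < ε)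
    (hε1 : ε < 1) (hb : b = 8 * (k * Real.log (n / ε) + 1 / ε)) :
    Real.exp (-(b * 1 / 2) + n * (Real.exp (-(b / (4 * k))) * (8 * k / (b * ε)))) ≤ ε := by
  have hk1 : (1 : ℝ) ≤ k := by exact_mod_cast hk0
  have hkn' : (k : ℝ) ≤ n := by exact_mod_cast hkn
  have hn1 : (1 : ℝ) ≤ n := hk1.trans hkn'
  have hinv : 1 ≤ 1 / ε := by rw [le_div_iff₀ hε]; linarith
  have hL : 0 ≤ Real.log (n / ε) := Real.log_nonneg (by rw [le_div_iff₀ hε]; linarith)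
  have hbε : 8 / ε ≤ b := by
    rw [hb, div_eq_mul_one_div]
    have : 0 ≤ k * Real.log (n / ε) := by positivity
    linarith
  have hb0 : 0 < b := lt_of_lt_of_le (by positivity) hbε
  -- The square cancels both the number `n` of vertices and, as `k ≤ n`, the factor `k` in `h2`.
  have h1 : Real.exp (-(b / (4 * k))) ≤ (ε / n) ^ 2 := by
    have : (ε / n) ^ 2 = Real.exp (-(2 * Real.log (n / ε))) := by
      rw [Real.exp_neg, two_mul, Real.exp_add, Real.exp_log (by positivity)]
      field_simp
    rw [this, Real.exp_le_exp, neg_le_neg_iff, le_div_iff₀ (by positivity), hb]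
    have : 0 ≤ 1 / ε := by positivity
    nlinarith
  have h2 : 8 * k / (b * ε) ≤ k := by
    rw [div_le_iff₀ (by positivity)]
    have : 8 ≤ b * ε := by rwa [div_le_iff₀ hε] at hbε
    nlinarith
  have h3 : n * (Real.exp (-(b / (4 * k))) * (8 * k / (b * ε))) ≤ 1 := by
    calc n * (Real.exp (-(b / (4 * k))) * (8 * k / (b * ε))) ≤ n * ((ε / n) ^ 2 * k) := by
          gcongr
      _ = ε ^ 2 * (k / n) := by field_simp
      _ ≤ 1 * 1 := by
          gcongr
          · nlinarith
          · rw [div_le_one (by positivity)]; exact hkn'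
      _ = 1 := one_mul 1
  refine (Real.exp_le_exp.2 ?_).trans ((exp_neg_div_le hε (a := 3) (by norm_num)).trans ?_)
  · have : 8 / ε = 8 * (1 / ε) := by ring
    have : 3 / ε = 3 * (1 / ε) := by ring
    linarith
  · linarith

/-- The guarantee of the adaptive strategy. -/
theorem adaptiveStrategy_approx {inc : E → Finset V} {k : ℕ} (hk0 : 1 ≤ k)
    (hk : ∀ e, (inc e).card = k) {cm cp : E → ℕ} {p ε : ℝ} (hp : 0 < p)
    (hε : 0 < ε) (hε1 : ε < 1) {D : E → PMF ℕ} {solve : Solver E}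
    {round : Rounding E} {T : ℕ} (hD : AdmissibleLaw cm cp p D) (hs : IsSolver inc solve)
    (hr : IsLPRelative inc (ratio k) round)
    (hT : 16 * ((maxGap cm cp : ℝ) * (k * Real.log (Fintype.card V / ε) + 1 / ε) / (ε * p)) ≤ T) :
    ENNReal.ofReal (1 - ε) ≤ prob (adaptiveStrategy cm cp solve round T D)
      (goodRuns inc ((1 - ε) / ((k : ℝ) - 1 + 1 / (k : ℝ)))) := by
  classical
  refine ofReal_one_sub_le_prob hε.le ?_
  have hbound : prob (adaptiveStrategy cm cp solve round T D)
      (goodRuns inc ((1 - ε) / ((k : ℝ) - 1 + 1 / (k : ℝ))))ᶜ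
      ≤ mean (piPMF D) fun c => mean (queryLaw cp solve c T) fun Q =>
        if Fails inc cm ε 1 Q c then 1 else 0 := by
    rw [prob_eq_mean, adaptiveStrategy, mean_bind]
    refine mean_mono fun c hc => ?_
    have hcs := fun e => (hD e).1 _ (piPMF_ne_zero hc e)
    rw [mean_map]
    refine mean_mono fun Q _ => ?_
    by_cases hF : Fails inc cm ε 1 Q c
    · rw [if_pos hF]; split_ifs <;> simp
    · rw [if_neg hF, if_neg]
      exact not_not.2 (hr.isApproxMatching hk0 (fun e => (hcs e).1) hF)
  refine hbound.trans ?_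
  have hgap' : ∀ e, cp e - cm e ≤ maxGap cm cp := fun e =>
    Finset.le_sup (f := fun e => cp e - cm e) (Finset.mem_univ e)
  -- With gap zero the weights are deterministic and no query is needed; the survival bound would
  -- divide by zero. A positive gap also provides an edge, hence `k ≤ n`.
  rcases Nat.eq_zero_or_pos (maxGap cm cp) with h0 | hpos
  · refine (mean_le_of_le (r := 0) fun c hc => mean_le_of_le fun Q _ => ?_).trans zero_le
    have hcs := fun e => (hD e).1 _ (piPMF_ne_zero hc e)
    rw [if_neg]
    rintro ⟨x, hx, h1, hlt⟩
    have hpess : pessimistic cm Q c = c := by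
      funext e
      have := hgap' e
      have := hcs e
      simp only [pessimistic]; split_ifs
      · rfl
      · omega
    have := hlt x hx
    rw [hpess] at this
    nlinarith
  · have hkn : k ≤ Fintype.card V := by
      obtain ⟨e, -⟩ : (Finset.univ : Finset E).Nonempty := by
        rw [Finset.nonempty_iff_ne_empty]
        intro he
        simp [maxGap, he] at hpos
      rw [← hk e]; exact Finset.card_le_univ _
    have hΔ : (0 : ℝ) < maxGap cm cp := by exact_mod_cast hpos
    have hgap : ∀ e, (cp e : ℝ) - cm e ≤ maxGap cm cp := fun e => by
      have : cp e ≤ maxGap cm cp + cm e := by have := hgap' e; omega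
      have : (cp e : ℝ) ≤ maxGap cm cp + cm e := by exact_mod_cast this
      linarith
    set b := 8 * (k * Real.log (Fintype.card V / ε) + 1 / ε) with hb
    have hn1 : (1 : ℝ) ≤ Fintype.card V := by exact_mod_cast hk0.trans hkn
    have hL : 0 ≤ Real.log (Fintype.card V / ε) :=
      Real.log_nonneg (by rw [le_div_iff₀ hε]; linarith)
    have hb0 : 0 < b := by positivity
    have hbT : b ≤ T * (p * (ε / 2 / maxGap cm cp)) := by
      have h1 := mul_le_mul_of_nonneg_right hT
        (show 0 ≤ p * (ε / 2 / maxGap cm cp) by positivity)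
      refine le_trans (le_of_eq ?_) h1
      rw [hb]; field_simp; norm_num
    exact (mean_fails_le hk0 hk hp.le hD hs hΔ hgap hε hε1 zero_le_one hb0 hbT).trans
      (ENNReal.ofReal_le_ofReal (failure_exponent_le hk0 hkn hε hε1 hb))

end Adaptive

/-! ### Lower tail of the value of a fixed fractional solution. -/

section Concentration

variable {V E : Type*} [Fintype V] [DecidableEq V] [Fintype E] [DecidableEq E]

theorem exp_neg_le_one_sub_half {z : ℝ} (h0 : 0 ≤ z) (h1 : z ≤ 1) : Real.exp (-z) ≤ 1 - z / 2 := by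
  rw [Real.exp_neg, inv_le_comm₀ (Real.exp_pos _) (by linarith)]
  refine le_trans ?_ (Real.add_one_le_exp z)
  rw [inv_le_iff_one_le_mul₀ (by linarith)]
  nlinarith

/-- A lower tail bound for the realized value of a fixed fractional solution. -/
theorem mean_lpValue_lt_le {cm cp : E → ℕ} {p B : ℝ} (hp : 0 ≤ p) (hB : 0 < B)
    (hcp : ∀ e, (cp e : ℝ) ≤ B) {D : E → PMF ℕ} (hD : AdmissibleLaw cm cp p D) {x : E → ℝ}
    (h0 : ∀ e, 0 ≤ x e) (h1 : ∀ e, x e ≤ 1) :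
    (mean (piPMF D) fun c => if lpValue c x < p * lpValue cp x / 4 then 1 else 0)
      ≤ ENNReal.ofReal (Real.exp (-(p * lpValue cp x / (4 * B)))) := by
  set m := lpValue cp x with hm
  have hfac : ∀ e, (mean (D e) fun a => ENNReal.ofReal (Real.exp (-(a * x e / B))))
      ≤ ENNReal.ofReal (Real.exp (-(p * (cp e * x e / B / 2)))) := by
    intro e
    have hxe := h0 e
    refine mean_le_exp hp (by positivity) (hD e).2 fun a => ?_
    have hz0 : ∀ a : ℕ, 0 ≤ a * x e / B := fun a => by positivity
    rcases eq_or_ne a (cp e) with rfl | ha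
    · rw [if_pos rfl, ← ENNReal.ofReal_add (Real.exp_pos _).le (by have := hz0 (cp e); linarith),
        ← ENNReal.ofReal_one]
      refine ENNReal.ofReal_le_ofReal ?_
      have := exp_neg_le_one_sub_half (hz0 (cp e)) (by
        rw [div_le_one hB]
        exact (mul_le_of_le_one_right (Nat.cast_nonneg _) (h1 e)).trans (hcp e))
      linarith
    · rw [if_neg ha, add_zero, ← ENNReal.ofReal_one]
      refine ENNReal.ofReal_le_ofReal (Real.exp_le_one_iff.2 ?_)
      have := hz0 a
      linarith
  -- Exponential Markov inequality: the moments multiply to at most `exp (-p m / (2B))`, and the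
  -- threshold `p m / 4` costs back a factor `exp (p m / (4B))`.
  calc (mean (piPMF D) fun c => if lpValue c x < p * m / 4 then 1 else 0)
      ≤ mean (piPMF D) fun c => ENNReal.ofReal (Real.exp (p * m / (4 * B))) *
          ∏ e, ENNReal.ofReal (Real.exp (-(c e * x e / B))) := by
        refine mean_mono fun c _ => ?_
        split_ifs with hlt
        · rw [← ENNReal.ofReal_prod_of_nonneg fun e _ => (Real.exp_pos _).le, ← Real.exp_sum,
            ← ENNReal.ofReal_mul (Real.exp_pos _).le, ← Real.exp_add, ← ENNReal.ofReal_one,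
            Finset.sum_neg_distrib, ← Finset.sum_div]
          refine ENNReal.ofReal_le_ofReal (Real.one_le_exp ?_)
          have h2 : lpValue c x / B ≤ p * m / 4 / B := by gcongr
          have h3 : p * m / 4 / B = p * m / (4 * B) := by field_simp
          unfold lpValue at h2
          linarith
        · exact zero_le
    _ = ENNReal.ofReal (Real.exp (p * m / (4 * B))) *
          ∏ e, mean (D e) fun a => ENNReal.ofReal (Real.exp (-(a * x e / B))) := by
        rw [mean_mul_left, mean_piPMF_prod D fun e a => ENNReal.ofReal (Real.exp (-(a * x e / B)))]
    _ ≤ ENNReal.ofReal (Real.exp (p * m / (4 * B))) *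
          ∏ e, ENNReal.ofReal (Real.exp (-(p * (cp e * x e / B / 2)))) :=
        mul_le_mul_right (Finset.prod_le_prod' fun e _ => hfac e) _
    _ = ENNReal.ofReal (Real.exp (-(p * m / (4 * B)))) := by
        rw [← ENNReal.ofReal_prod_of_nonneg fun e _ => (Real.exp_pos _).le, ← Real.exp_sum,
          ← ENNReal.ofReal_mul (Real.exp_pos _).le, ← Real.exp_add]
        congr 2
        rw [Finset.sum_neg_distrib, ← Finset.mul_sum, ← Finset.sum_div, ← Finset.sum_div]
        change p * m / (4 * B) + -(p * (m / B / 2)) = -(p * m / (4 * B))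
        field_simp; ring

end Concentration

/-! ### Random colourings and the matchings that survive them. -/

section Coloring

variable {V E : Type*} [Fintype V] [DecidableEq V] [Fintype E] [DecidableEq E]

theorem mean_uniform_equiv {α : Type*} [Fintype α] [Nonempty α] (s : α ≃ α) (f : α → ℝ≥0∞) :
    (mean (PMF.uniformOfFintype α) fun a => f (s a)) = mean (PMF.uniformOfFintype α) f := by
  simp only [mean, PMF.uniformOfFintype_apply]
  exact s.tsum_eq fun a => _ * f a

/-- Shifting the colour of `u` cyclically preserves the uniform law, so the `N + 1` events `χ u + i
= χ v` are equally likely; exactly one of them occurs. -/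
theorem mean_color_eq {N : ℕ} {u v : V} (huv : u ≠ v) :
    (mean (PMF.uniformOfFintype (V → Fin (N + 1))) fun χ => if χ u = χ v then 1 else 0)
      = ENNReal.ofReal (1 / (N + 1)) := by
  set P := PMF.uniformOfFintype (V → Fin (N + 1))
  have h1 : ∀ i : Fin (N + 1), (mean P fun χ => if χ u + i = χ v then (1 : ℝ≥0∞) else 0)
      = mean P fun χ => if χ u = χ v then 1 else 0 := fun i => by
    refine Eq.trans ?_ (mean_uniform_equiv (Equiv.addRight (Pi.single u i))
      fun χ : V → Fin (N + 1) => if χ u = χ v then (1 : ℝ≥0∞) else 0)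
    simp [P, huv.symm]
  have h2 : ∑ i : Fin (N + 1), (mean P fun χ => if χ u + i = χ v then (1 : ℝ≥0∞) else 0) = 1 := by
    rw [← mean_sum]
    refine Eq.trans ?_ (mean_const P 1)
    congr 1; funext χ
    rw [Finset.sum_eq_single (χ v - χ u)]
    · simp
    · intro i _ hi
      rw [if_neg fun h => hi (by rw [← h]; abel)]
    · simp
  rw [Finset.sum_congr rfl fun i _ => h1 i, Finset.sum_const, Finset.card_univ, Fintype.card_fin,
    nsmul_eq_mul] at h2
  rw [mul_comm] at h2
  rw [ENNReal.eq_inv_of_mul_eq_one_left h2, one_div, ENNReal.ofReal_inv_of_pos (by positivity)]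
  congr 1
  rw [ENNReal.ofReal_add (by positivity) (by norm_num)]
  simp

/-- A vertex of `e` shares its colour with another vertex of `M`. -/
def Clash {K : Type*} (inc : E → Finset V) (χ : V → K) (M : Finset E) (e : E) : Prop :=
  ∃ u ∈ inc e, ∃ v ∈ M.biUnion inc, u ≠ v ∧ χ u = χ v

-- Union bound over the `k` vertices of `e` and the at most `k |M|` vertices covered by `M`.
open Classical in
theorem mean_clash_le {inc : E → Finset V} {k : ℕ} (hk : ∀ e, (inc e).card = k) (M : Finset E)
    (N : ℕ) (e : E) : (mean (PMF.uniformOfFintype (V → Fin (N + 1))) fun χ =>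
      if Clash inc χ M e then 1 else 0) ≤ ENNReal.ofReal (k * (k * M.card) / (N + 1)) := by
  set P := PMF.uniformOfFintype (V → Fin (N + 1))
  calc (mean P fun χ => if Clash inc χ M e then 1 else 0)
      ≤ mean P fun χ => ∑ u ∈ inc e, ∑ v ∈ M.biUnion inc,
          if u ≠ v ∧ χ u = χ v then (1 : ℝ≥0∞) else 0 := by
        refine mean_mono fun χ _ => ?_
        split_ifs with h
        · obtain ⟨u, hu, v, hv, huv⟩ := h
          refine le_trans ?_ (Finset.single_le_sum (f := fun u => ∑ v ∈ M.biUnion inc,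
            if u ≠ v ∧ χ u = χ v then (1 : ℝ≥0∞) else 0) (fun _ _ => zero_le) hu)
          refine le_trans ?_ (Finset.single_le_sum (f := fun v =>
            if u ≠ v ∧ χ u = χ v then (1 : ℝ≥0∞) else 0) (fun _ _ => zero_le) hv)
          rw [if_pos huv]
        · exact zero_le
    _ ≤ ∑ u ∈ inc e, ∑ v ∈ M.biUnion inc, ENNReal.ofReal (1 / (N + 1)) := by
        rw [mean_sum]
        refine Finset.sum_le_sum fun u _ => ?_
        rw [mean_sum]
        refine Finset.sum_le_sum fun v _ => ?_
        by_cases huv : u = v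
        · refine mean_le_of_le fun χ _ => ?_
          rw [if_neg fun h => h.1 huv]; exact zero_le
        · rw [← mean_color_eq huv]
          exact mean_mono fun χ _ => by simp [huv]
    _ ≤ ENNReal.ofReal (k * (k * M.card) / (N + 1)) := by
        have hcard : (M.biUnion inc).card ≤ M.card * k :=
          Finset.card_biUnion_le_card_mul _ _ _ fun e _ => (hk e).le
        rw [Finset.sum_const, Finset.sum_const, hk, ← mul_smul, nsmul_eq_mul,
          ← ENNReal.ofReal_natCast, ← ENNReal.ofReal_mul (Nat.cast_nonneg _)]
        refine ENNReal.ofReal_le_ofReal ?_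
        rw [mul_one_div]
        gcongr
        rw [mul_comm (k : ℝ) (M.card : ℝ)]
        exact_mod_cast Nat.mul_le_mul_left k hcard

open Classical in
/-- With many colours, few edges of a fixed matching are destroyed. -/
theorem mean_clash_weight_le {inc : E → Finset V} {k : ℕ} (hk : ∀ e, (inc e).card = k)
    (M : Finset E) (c : E → ℕ) {ε : ℝ} (hε : 0 < ε) {N : ℕ}
    (hN : 8 * k ^ 2 * M.card / ε ^ 2 ≤ N + 1) :
    (mean (PMF.uniformOfFintype (V → Fin (N + 1))) fun χ =>
      if ε / 2 * (weight c M : ℝ) < weight c (M.filter (Clash inc χ M)) then 1 else 0)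
      ≤ ENNReal.ofReal (ε / 4) := by
  set P := PMF.uniformOfFintype (V → Fin (N + 1))
  rcases Nat.eq_zero_or_pos (weight c M) with h0 | hpos
  · refine (mean_le_of_le (r := 0) fun χ _ => ?_).trans zero_le
    rw [if_neg]
    have : weight c (M.filter (Clash inc χ M)) ≤ weight c M :=
      Finset.sum_le_sum_of_subset (Finset.filter_subset _ _)
    rw [h0] at this ⊢
    simp [Nat.le_zero.1 this]
  have hW : (0 : ℝ) < weight c M := by exact_mod_cast hpos
  -- Markov's inequality for the destroyed weight. By the choice of `N` its mean is at most `ε² / 8`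
  -- of the total, so exceeding the fraction `ε / 2` has probability at most `ε / 4`.
  have hmarkov : ENNReal.ofReal (ε / 2 * (weight c M : ℝ)) * (mean P fun χ =>
      if ε / 2 * (weight c M : ℝ) < weight c (M.filter (Clash inc χ M)) then 1 else 0)
      ≤ ∑ e ∈ M, mean P fun χ => (c e : ℝ≥0∞) * if Clash inc χ M e then 1 else 0 := by
    rw [← mean_mul_left, ← mean_sum]
    refine mean_mono fun χ _ => ?_
    split_ifs with hlt
    · rw [mul_one]
      refine (ENNReal.ofReal_le_ofReal hlt.le).trans_eq ?_
      rw [ENNReal.ofReal_natCast, weight, Nat.cast_sum, Finset.sum_filter]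
      exact Finset.sum_congr rfl fun e _ => by split_ifs <;> simp
    · rw [mul_zero]; exact zero_le
  have hsum : ∑ e ∈ M, (mean P fun χ => (c e : ℝ≥0∞) * if Clash inc χ M e then 1 else 0)
      ≤ ENNReal.ofReal (weight c M * (k * (k * M.card) / (N + 1))) := by
    rw [ENNReal.ofReal_mul hW.le, ENNReal.ofReal_natCast, weight, Nat.cast_sum, Finset.sum_mul]
    refine Finset.sum_le_sum fun e _ => ?_
    rw [mean_mul_left]
    exact mul_le_mul_right (mean_clash_le hk M N e) _
  have hle : (weight c M : ℝ) * (k * (k * M.card) / (N + 1))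
      ≤ ε / 2 * (weight c M : ℝ) * (ε / 4) := by
    have h1 : (k : ℝ) * (k * M.card) / (N + 1) ≤ ε ^ 2 / 8 := by
      rw [div_le_iff₀ (by positivity)]
      rw [div_le_iff₀ (by positivity)] at hN
      nlinarith
    calc (weight c M : ℝ) * (k * (k * M.card) / (N + 1)) ≤ weight c M * (ε ^ 2 / 8) := by gcongr
      _ = ε / 2 * (weight c M : ℝ) * (ε / 4) := by ring
  have hfin := (hmarkov.trans hsum).trans (ENNReal.ofReal_le_ofReal hle)
  rw [ENNReal.ofReal_mul (q := ε / 4) (by positivity)] at hfin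
  exact (ENNReal.mul_le_mul_iff_right (by simpa using by positivity) ENNReal.ofReal_ne_top).1 hfin

open Classical in
/-- The surviving part of a matching is a matching of the sparsified hypergraph. -/
theorem IsMatching.exists_colorful {inc : E → Finset V} {M : Finset E} (hM : IsMatching inc M)
    {K : Type*} [Fintype K] [DecidableEq K] (χ : V → K) (c : E → ℕ) :
    ∃ M' : Finset (Colorful inc χ), IsMatching (colorInc inc χ) M' ∧
      weight (fun e : Colorful inc χ => c e.1) M' + weight c (M.filter (Clash inc χ M))
        = weight c M := by
  have hcol : ∀ e ∈ M, ¬ Clash inc χ M e → ((inc e).image χ).card = (inc e).card := by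
    intro e he hcl
    refine Finset.card_image_of_injOn fun u hu v hv huv => ?_
    by_contra hne
    exact hcl ⟨u, hu, v, Finset.mem_biUnion.2 ⟨e, he, hv⟩, hne, huv⟩
  refine ⟨(M.filter fun e => ¬ Clash inc χ M e).subtype
    (fun e => ((inc e).image χ).card = (inc e).card), ?_, ?_⟩
  · rw [isMatching_iff] at hM ⊢
    intro κ e he e' he' hκ hκ'
    rw [Finset.mem_subtype, Finset.mem_filter] at he he'
    obtain ⟨u, hu, rfl⟩ := Finset.mem_image.1 hκ
    obtain ⟨v, hv, hvu⟩ := Finset.mem_image.1 hκ'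
    have huv : u = v := by
      by_contra hne
      exact he.2 ⟨u, hu, v, Finset.mem_biUnion.2 ⟨_, he'.1, hv⟩, hne, hvu.symm⟩
    subst huv
    exact Subtype.ext (hM u _ he.1 _ he'.1 hu hv)
  · have : weight (fun e : Colorful inc χ => c e.1) ((M.filter fun e => ¬ Clash inc χ M e).subtype
        (fun e => ((inc e).image χ).card = (inc e).card))
        = weight c (M.filter fun e => ¬ Clash inc χ M e) := by
      unfold weight
      rw [Finset.sum_subtype_of_mem (f := c)]
      intro e he
      rw [Finset.mem_filter] at he
      exact hcol e he.1 he.2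
    rw [this, weight, weight, weight, add_comm, Finset.sum_filter_add_sum_filter_not]

theorem IsMatching.map_colorful {inc : E → Finset V} {K : Type*} [Fintype K] [DecidableEq K]
    {χ : V → K} {M : Finset (Colorful inc χ)} (hM : IsMatching (colorInc inc χ) M) :
    IsMatching inc (M.map (Function.Embedding.subtype _)) := by
  rw [isMatching_iff] at hM ⊢
  intro u e he e' he' hu hu'
  obtain ⟨f, hf, rfl⟩ := Finset.mem_map.1 he
  obtain ⟨f', hf', rfl⟩ := Finset.mem_map.1 he'
  rw [hM (χ u) f hf f' hf' (Finset.mem_image_of_mem _ hu) (Finset.mem_image_of_mem _ hu')]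

end Coloring

/-! ### Expected number of queries at a vertex. -/

section Degree

variable {V E : Type*} [Fintype V] [DecidableEq V] [Fintype E] [DecidableEq E]

/-- Every iteration queries at most one edge at each vertex, in expectation. -/
theorem mean_queried_le {inc : E → Finset V} (hne : ∀ e, (inc e).Nonempty) (cp : E → ℕ)
    {solve : Solver E} (hs : IsSolver inc solve) (c : E → ℕ) (u : V) (t : ℕ) :
    (mean (queryLaw cp solve c t) fun Q =>
      ((Q.filter fun e => u ∈ inc e).card : ℝ≥0∞)) ≤ t := by
  induction t with
  | zero => simp [queryLaw, mean_pure]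
  | succ t ih =>
    rw [queryLaw, mean_bind]
    have hstep : ∀ Q, (mean ((randomSubset (solve t Q (optimistic cp Q c))).map fun S => Q ∪ S)
        fun Q => ((Q.filter fun e => u ∈ inc e).card : ℝ≥0∞))
        ≤ (Q.filter fun e => u ∈ inc e).card + 1 := by
      intro Q
      have hopt := hs t Q (optimistic cp Q c)
      set x := solve t Q (optimistic cp Q c)
      rw [mean_map]
      calc (mean (randomSubset x) fun S => (((Q ∪ S).filter fun e => u ∈ inc e).card : ℝ≥0∞))
          ≤ mean (randomSubset x) fun S => ((Q.filter fun e => u ∈ inc e).card : ℝ≥0∞)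
            + ∑ e ∈ Finset.univ.filter (fun e => u ∈ inc e), if e ∈ S then 1 else 0 := by
            refine mean_mono fun S _ => ?_
            rw [Finset.filter_union, Finset.sum_boole, Finset.filter_filter]
            have : (Finset.univ.filter fun e => u ∈ inc e ∧ e ∈ S)
                = S.filter fun e => u ∈ inc e := by
              ext e; simp [and_comm]
            rw [this]
            exact_mod_cast Finset.card_union_le _ _
        _ = (Q.filter fun e => u ∈ inc e).card
            + ENNReal.ofReal (∑ e ∈ Finset.univ.filter (fun e => u ∈ inc e), x e) := by
            rw [mean_add, mean_const, mean_sum,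
              ENNReal.ofReal_sum_of_nonneg fun e _ => hopt.1.1 e]
            congr 1
            exact Finset.sum_congr rfl fun e _ =>
              mean_randomSubset_mem hopt.1.1 (hopt.1.le_one hne) e
        _ ≤ (Q.filter fun e => u ∈ inc e).card + 1 := by
            refine add_le_add_right ?_ _
            rw [← ENNReal.ofReal_one]
            exact ENNReal.ofReal_le_ofReal (hopt.1.2 u)
    refine (mean_mono fun Q _ => hstep Q).trans ?_
    rw [mean_add, mean_const]
    push_cast
    exact add_le_add_left ih _

end Degree

/-! ### The guarantee after vertex sparsification. -/

section Sparsified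

variable {V E : Type*} [Fintype V] [DecidableEq V] [Fintype E] [DecidableEq E]

/-- The bound on `n` is proportional to `μ₀`, so the union bound costs at most `μ₀` in the exponent
and is absorbed by `b μ₀ / 2`. The cube of `ε p / k` cancels `k ^ 3 / (p ε ^ 3)`, and `4160 = 16 *
260` makes the remaining factor `1 / (260 B)`. -/
theorem sparsified_failure_exponent_le {k : ℕ} {B p ε μ₀ n b : ℝ} (hk0 : 1 ≤ k) (hB : 1 ≤ B)
    (hp : 0 < p) (hp1 : p ≤ 1) (hε : 0 < ε) (hε1 : ε < 1)
    (hn : n ≤ μ₀ * (260 * B * k ^ 3 / (p * ε ^ 3))) (hμ₀ : 1 / 2 ≤ μ₀)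
    (hb : b = 4160 * B * (k * (Real.log (k / (ε * p)) + 1 / ε))) :
    Real.exp (-(b * μ₀ / 2) + n * (Real.exp (-(b / (4 * k))) * (8 * k / (b * (ε / 2)))))
      ≤ ε / 2 := by
  have hk1 : (1 : ℝ) ≤ k := by exact_mod_cast hk0
  have hk2 : (0 : ℝ) < k := by linarith
  have hinv : 1 ≤ 1 / ε := by rw [le_div_iff₀ hε]; linarith
  have hεp : ε * p ≤ 1 := by nlinarith
  have hεp0 : 0 < ε * p := by positivity
  have hL : 0 ≤ Real.log (k / (ε * p)) := Real.log_nonneg (by rw [le_div_iff₀ hεp0]; linarith)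
  set L := Real.log (k / (ε * p)) with hLdef
  have hbk : 4160 * B * k / ε ≤ b := by
    rw [hb]
    have h1 : 0 ≤ 4160 * B * k * L := by positivity
    have h2 : 4160 * B * k / ε = 4160 * B * k * (1 / ε) := by ring
    have h3 : 4160 * B * (k * (L + 1 / ε)) = 4160 * B * k * L + 4160 * B * k * (1 / ε) := by ring
    linarith
  have hb0 : 0 < b := lt_of_lt_of_le (by positivity) hbk
  have h1 : Real.exp (-(b / (4 * k))) ≤ (ε * p / k) ^ 3 := by
    have : (ε * p / k) ^ 3 = Real.exp (-(3 * L)) := by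
      have h3 : Real.exp (-(3 * L)) = Real.exp (-L) ^ 3 := by
        rw [← Real.exp_nat_mul]; congr 1; push_cast; ring
      rw [h3, Real.exp_neg, hLdef, Real.exp_log (by positivity), inv_div]
    rw [this, Real.exp_le_exp, neg_le_neg_iff, le_div_iff₀ (by positivity), hb]
    have h4 : 0 ≤ B * k * (1 / ε) := by positivity
    have h5 : k * L ≤ B * (k * L) := le_mul_of_one_le_left (by positivity) hB
    nlinarith
  have h2 : 8 * k / (b * (ε / 2)) ≤ 1 / (260 * B) := by
    rw [div_le_div_iff₀ (by positivity) (by positivity)]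
    have : 4160 * B * k ≤ b * ε := by rwa [div_le_iff₀ hε] at hbk
    linarith
  have h3 : n * (Real.exp (-(b / (4 * k))) * (8 * k / (b * (ε / 2)))) ≤ μ₀ := by
    calc n * (Real.exp (-(b / (4 * k))) * (8 * k / (b * (ε / 2))))
        ≤ μ₀ * (260 * B * k ^ 3 / (p * ε ^ 3)) *
          (Real.exp (-(b / (4 * k))) * (8 * k / (b * (ε / 2)))) :=
          mul_le_mul_of_nonneg_right hn (by positivity)
      _ ≤ μ₀ * (260 * B * k ^ 3 / (p * ε ^ 3)) * ((ε * p / k) ^ 3 * (1 / (260 * B))) := by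
          gcongr
      _ = μ₀ * p ^ 2 := by field_simp
      _ ≤ μ₀ := mul_le_of_le_one_right (by linarith) (by nlinarith)
  refine (Real.exp_le_exp.2 ?_).trans ((exp_neg_div_le hε (a := 2) (by norm_num)).trans le_rfl)
  have h4 : 4160 * (1 / ε) ≤ b := by
    refine le_trans ?_ hbk
    have : 1 ≤ B * k := by nlinarith
    have h6 : 4160 * B * k / ε = 4160 * (1 / ε) * (B * k) := by ring
    rw [h6]
    exact le_mul_of_one_le_right (by positivity) this
  have h5 : 2 / ε = 2 * (1 / ε) := by ring
  rw [h5]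
  nlinarith

/-- Edges of weight zero are removed from an optimal matching; by integrality its size is then at
most its weight. -/
theorem exists_max_matching (inc : E → Finset V) (c : E → ℕ) :
    ∃ M, IsMatching inc M ∧ (∀ M', IsMatching inc M' → weight c M' ≤ weight c M) ∧
      M.card ≤ weight c M := by
  classical
  obtain ⟨M, hM, hmax⟩ := Finset.exists_max_image
    ((Finset.univ : Finset (Finset E)).filter (IsMatching inc)) (weight c)
    ⟨∅, by simp [IsMatching]⟩
  have hw : weight c (M.filter fun e => c e ≠ 0) = weight c M := Finset.sum_filter_ne_zero _
  refine ⟨M.filter fun e => c e ≠ 0, fun u => le_trans (Finset.card_le_card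
    (Finset.filter_subset_filter _ (Finset.filter_subset _ _))) ((Finset.mem_filter.1 hM).2 u),
    fun M' hM' => (hmax M' (by simpa using hM')).trans_eq hw.symm, ?_⟩
  rw [Finset.card_eq_sum_ones]
  exact Finset.sum_le_sum fun e he => Nat.one_le_iff_ne_zero.2 (Finset.mem_filter.1 he).2

-- The accuracy `ε` is spent in two halves, on the colouring and on the adaptive strategy, using `(1
-- - ε / 2) ^ 2 ≥ 1 - ε`. The surviving part of `M` keeps at least half of its weight, which is why
-- `μ₀` is compared with half the optimum.
open Classical in
theorem IsLPRelative.isApproxMatching_map {inc : E → Finset V} {k : ℕ} (hk0 : 1 ≤ k)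
    {K : Type*} [Fintype K] [DecidableEq K] {χ : V → K} {round : Rounding (Colorful inc χ)}
    (hr : IsLPRelative (colorInc inc χ) (ratio k) round) {cm c : E → ℕ}
    {Q : Finset (Colorful inc χ)} (hcm : ∀ e, cm e ≤ c e) {ε μ₀ : ℝ} (hε : 0 < ε) (hε1 : ε < 1)
    {M : Finset E} (hM : IsMatching inc M) (hmax : ∀ M', IsMatching inc M' → weight c M' ≤ weight c M)
    (hμ : 1 ≤ weight c M → μ₀ ≤ (weight c M : ℝ) / 2)
    (hclash : ¬ ε / 2 * (weight c M : ℝ) < weight c (M.filter (Clash inc χ M)))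
    (hF : ¬ Fails (colorInc inc χ) (fun e => cm e.1) (ε / 2) μ₀ Q fun e => c e.1) :
    IsApproxMatching inc c ((1 - ε) / ((k : ℝ) - 1 + 1 / (k : ℝ)))
      ((round Q (pessimistic (fun e => cm e.1) Q fun e => c e.1)).map
        (Function.Embedding.subtype _)) := by
  refine ⟨(hr Q _).1.map_colorful, fun M' hM' => ?_⟩
  have hβ := ratio_inv_pos hk0
  refine le_trans (mul_le_mul_of_nonneg_left (Nat.cast_le.2 (hmax M' hM'))
    (div_nonneg (by linarith) hβ.le)) ?_
  rcases Nat.eq_zero_or_pos (weight c M) with h0 | hpos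
  · rw [h0]; simp
  have hW : (1 : ℝ) ≤ weight c M := by exact_mod_cast hpos
  by_contra! hlt
  obtain ⟨G, hG, hGw⟩ := hM.exists_colorful χ c
  have hGw' : (1 - ε / 2) * (weight c M : ℝ) ≤ weight (fun e : Colorful inc χ => c e.1) G := by
    have h1 : (weight (fun e : Colorful inc χ => c e.1) G : ℝ)
        + weight c (M.filter (Clash inc χ M)) = weight c M := by exact_mod_cast hGw
    rw [not_lt] at hclash
    linarith
  refine hF ⟨_, hG.lpFeasible, ?_, fun x' hx' => ?_⟩
  · rw [lpValue_indicator]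
    refine (hμ hpos).trans (le_trans ?_ hGw')
    nlinarith
  · rw [lpValue_indicator]
    set out := round Q (pessimistic (fun e => cm e.1) Q fun e => c e.1)
    have h1 := (hr Q (pessimistic (fun e => cm e.1) Q fun e => c e.1)).2 x' hx'
    have h2 : ((weight (pessimistic (fun e => cm e.1) Q fun e => c e.1) out : ℕ) : ℝ)
        ≤ weight c (out.map (Function.Embedding.subtype _)) := by
      refine Nat.cast_le.2 ((weight_pessimistic_le (fun e : Colorful inc χ => hcm e.1) _).trans_eq ?_)
      simp [weight]
    have h3 := (h1.trans h2).trans_lt hlt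
    rw [ratio, one_div_mul_eq_div, div_mul_eq_mul_div, div_lt_div_iff_of_pos_right hβ] at h3
    refine h3.trans_le ?_
    have := mul_le_mul_of_nonneg_left hGw' (show 0 ≤ 1 - ε / 2 by linarith)
    nlinarith [mul_nonneg (sq_nonneg ε) (zero_le_one.trans hW)]

theorem mean_queriesAt_le {inc : E → Finset V} (hne : ∀ e, (inc e).Nonempty) (cm cp : E → ℕ)
    {N : ℕ} {solve : ∀ χ : V → Fin (N + 1), Solver (Colorful inc χ)}
    (hs : ∀ χ, IsSolver (colorInc inc χ) (solve χ))
    (round : ∀ χ : V → Fin (N + 1), Rounding (Colorful inc χ)) (T : ℕ) (D : E → PMF ℕ) (u : V) :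
    expectation (sparsifiedStrategy inc cm cp N solve round T D) (queriesAt inc u) ≤ T := by
  rw [expectation_eq_mean, sparsifiedStrategy, mean_bind]
  refine mean_le_of_le fun χ _ => ?_
  rw [mean_bind]
  refine mean_le_of_le fun c _ => ?_
  rw [mean_map]
  refine le_trans (mean_mono fun Q _ => ?_) (mean_queried_le (inc := colorInc inc χ)
    (fun e => (hne e.1).image χ) _ (hs χ) (fun e => c e.1) (χ u) T)
  refine Nat.cast_le.2 ?_
  rw [queriesAt, Finset.filter_map, Finset.card_map]
  refine Finset.card_le_card fun e he => ?_
  rw [Finset.mem_filter] at he ⊢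
  exact ⟨he.1, Finset.mem_image_of_mem _ he.2⟩

/-- The guarantee of the adaptive strategy after vertex sparsification, when the number of colours is
proportional to the optimistic value of the relaxation. -/
theorem sparsifiedStrategy_approx {inc : E → Finset V} {k : ℕ} (hk0 : 1 ≤ k)
    (hk : ∀ e, (inc e).card = k) {cm cp : E → ℕ} {B p ε : ℝ} (hB : 1 ≤ B)
    (hcp : ∀ e, (cp e : ℝ) ≤ B) (hp : 0 < p) (hp1 : p ≤ 1) (hε : 0 < ε) (hε1 : ε < 1)
    {x₀ : E → ℝ} (hx₀ : LPOptimal inc cp x₀) {N T : ℕ}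
    (hN : 8 * k ^ 2 * lpValue cp x₀ / ε ^ 2 ≤ N + 1)
    (hN' : (N : ℝ) + 1 ≤ 8 * k ^ 2 * lpValue cp x₀ / ε ^ 2 + 2) {b : ℝ}
    (hb : b = 4160 * B * (k * (Real.log (k / (ε * p)) + 1 / ε)))
    (hT : b ≤ T * (p * (ε / 2 / 2 / B))) {D : E → PMF ℕ} (hD : AdmissibleLaw cm cp p D)
    {solve : ∀ χ : V → Fin (N + 1), Solver (Colorful inc χ)}
    {round : ∀ χ : V → Fin (N + 1), Rounding (Colorful inc χ)}
    (hs : ∀ χ, IsSolver (colorInc inc χ) (solve χ))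
    (hr : ∀ χ, IsLPRelative (colorInc inc χ) (ratio k) (round χ)) :
    ENNReal.ofReal (1 - ε) ≤ prob (sparsifiedStrategy inc cm cp N solve round T D)
      (goodRuns inc ((1 - ε) / ((k : ℝ) - 1 + 1 / (k : ℝ)))) := by
  classical
  have hne : ∀ e, (inc e).Nonempty := fun e => Finset.card_pos.1 (by rw [hk]; omega)
  have hk1 : (1 : ℝ) ≤ k := by exact_mod_cast hk0
  have hkpos : (0 : ℝ) < k := by linarith
  set m := lpValue cp x₀ with hm
  have hm0 : 0 ≤ m := hx₀.nonneg
  choose M hM hmax hcard using exists_max_matching inc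
  let Large : Prop := 16 * B / (p * ε) ≤ m
  -- For large `m`, concentration gives `x₀` realized value at least `p m / 4`, hence an optimum of
  -- at least `p m / (4k)`, of which half is kept. For small `m` the number of colours is already
  -- bounded independently of `n`, and the trivial bound from an optimum of at least `1` is enough.
  let μ₀ : ℝ := if Large then max (1 / 2) (p * m / (8 * k)) else 1 / 2
  have hμ₀ : 1 / 2 ≤ μ₀ := by
    simp only [μ₀]; split_ifs; exacts [le_max_left _ _, le_rfl]
  let F₁ : (E → ℕ) → ℝ≥0∞ := fun c => if Large ∧ lpValue c x₀ < p * m / 4 then 1 else 0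
  let F₂ : (V → Fin (N + 1)) → (E → ℕ) → ℝ≥0∞ := fun χ c =>
    if ε / 2 * (weight c (M c) : ℝ) < weight c ((M c).filter (Clash inc χ (M c))) then 1 else 0
  let F₃ : ∀ χ : V → Fin (N + 1), (E → ℕ) → Finset (Colorful inc χ) → ℝ≥0∞ := fun χ c Q =>
    if Fails (colorInc inc χ) (fun e => cm e.1) (ε / 2) μ₀ Q fun e => c e.1 then 1 else 0
  have hOPT : ∀ c, lpValue c x₀ / k ≤ weight c (M c) := by
    intro c
    obtain ⟨M', hM', hle⟩ := hx₀.1.exists_matching hk0 hk c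
    refine le_trans ?_ (hle.trans (Nat.cast_le.2 (hmax c M' hM')))
    rw [ratio, one_div_mul_eq_div]
    refine div_le_div_of_nonneg_left (lpValue_nonneg c hx₀.1.1) (ratio_inv_pos hk0) ?_
    have : 1 / (k : ℝ) ≤ 1 := by rw [div_le_one hkpos]; exact hk1
    linarith
  have hbound : prob (sparsifiedStrategy inc cm cp N solve round T D)
      (goodRuns inc ((1 - ε) / ((k : ℝ) - 1 + 1 / (k : ℝ))))ᶜ
      ≤ mean (PMF.uniformOfFintype (V → Fin (N + 1))) fun χ => mean (piPMF D) fun c =>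
        F₁ c + F₂ χ c +
          mean (queryLaw (fun e : Colorful inc χ => cp e.1) (solve χ) (fun e => c e.1) T)
            (F₃ χ c) := by
    rw [prob_eq_mean, sparsifiedStrategy, mean_bind]
    refine mean_mono fun χ _ => ?_
    rw [mean_bind]
    refine mean_mono fun c hc => ?_
    have hcs := fun e => (hD e).1 _ (piPMF_ne_zero hc e)
    rw [mean_map, ← mean_const (queryLaw (fun e : Colorful inc χ => cp e.1) (solve χ)
      (fun e => c e.1) T) (F₁ c + F₂ χ c), ← mean_add]
    refine mean_mono fun Q _ => ?_
    split_ifs with hbad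
    swap
    · exact zero_le
    by_contra! hlt
    have h1 : ¬ (Large ∧ lpValue c x₀ < p * m / 4) := fun h => by
      refine absurd hlt (not_lt.2 ?_)
      rw [add_assoc]
      exact le_trans (by simp only [F₁, if_pos h]; exact le_rfl) (self_le_add_right _ _)
    have h2 : ¬ ε / 2 * (weight c (M c) : ℝ) < weight c ((M c).filter (Clash inc χ (M c))) :=
      fun h => by
        refine absurd hlt (not_lt.2 ?_)
        rw [add_assoc, add_left_comm]
        exact le_trans (by simp only [F₂, if_pos h]; exact le_rfl) (self_le_add_right _ _)
    have h3 : ¬ Fails (colorInc inc χ) (fun e => cm e.1) (ε / 2) μ₀ Q fun e => c e.1 := fun h => by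
      refine absurd hlt (not_lt.2 ?_)
      exact le_trans (by simp only [F₃, if_pos h]; exact le_rfl) (self_le_add_left _ _)
    refine hbad ((hr χ).isApproxMatching_map hk0 (fun e => (hcs e).1) hε hε1 (hM c) (hmax c)
      (fun hW => ?_) h2 h3)
    have hW' : (1 : ℝ) ≤ weight c (M c) := by exact_mod_cast hW
    simp only [μ₀]
    split_ifs with hl
    · refine max_le (by linarith) ?_
      have h4 : p * m / 4 ≤ lpValue c x₀ := not_lt.1 fun h => h1 ⟨hl, h⟩
      have h5 : p * m / 4 / k ≤ lpValue c x₀ / k := by gcongr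
      have h6 : p * m / (8 * k) = p * m / 4 / k / 2 := by field_simp; ring
      rw [h6]
      linarith [hOPT c]
    · linarith
  have hF₁ : mean (piPMF D) F₁ ≤ ENNReal.ofReal (ε / 4) := by
    by_cases hl : Large
    · simp only [F₁, hl, true_and]
      refine (mean_lpValue_lt_le hp.le (by linarith) hcp hD hx₀.1.1
        (hx₀.1.le_one hne)).trans (ENNReal.ofReal_le_ofReal ?_)
      refine (Real.exp_le_exp.2 ?_).trans (exp_neg_div_le hε (a := 4) (by norm_num))
      rw [neg_le_neg_iff, ← hm, le_div_iff₀ (by positivity)]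
      have h1 : 16 * B / (p * ε) ≤ m := hl
      rw [div_le_iff₀ (by positivity)] at h1
      rw [div_mul_eq_mul_div, div_le_iff₀ hε]
      nlinarith
    · simp only [F₁, hl, false_and, if_false]
      exact mean_le_of_le fun _ _ => zero_le
  have hF₂ : ∀ c, piPMF D c ≠ 0 →
      (mean (PMF.uniformOfFintype (V → Fin (N + 1))) fun χ => F₂ χ c)
        ≤ ENNReal.ofReal (ε / 4) := by
    intro c hc
    have hcs := fun e => (hD e).1 _ (piPMF_ne_zero hc e)
    refine mean_clash_weight_le hk (M c) c hε (le_trans ?_ hN)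
    have h1 : ((M c).card : ℝ) ≤ m := by
      calc ((M c).card : ℝ) ≤ weight c (M c) := Nat.cast_le.2 (hcard c)
        _ ≤ weight cp (M c) := Nat.cast_le.2 (Finset.sum_le_sum fun e _ => (hcs e).2)
        _ ≤ m := by
          rw [← lpValue_indicator]
          exact hx₀.2 _ (hM c).lpFeasible
    gcongr
  have hF₃ : ∀ χ : V → Fin (N + 1), (mean (piPMF D) fun c =>
      mean (queryLaw (fun e : Colorful inc χ => cp e.1) (solve χ) (fun e => c e.1) T) (F₃ χ c))
        ≤ ENNReal.ofReal (ε / 2) := by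
    intro χ
    have hmap := mean_map (piPMF D)
      (fun (c : E → ℕ) (e : {e // ((inc e).image χ).card = (inc e).card}) => c e.1)
      (fun c => mean (queryLaw (fun e : Colorful inc χ => cp e.1) (solve χ) c T) fun Q =>
        if Fails (colorInc inc χ) (fun e => cm e.1) (ε / 2) μ₀ Q c then (1 : ℝ≥0∞) else 0)
    rw [piPMF_map_restrict] at hmap
    refine hmap.symm.trans_le ?_
    have hb0 : 0 < b := by
      rw [hb]
      have : 0 ≤ Real.log (k / (ε * p)) := Real.log_nonneg (by
        rw [le_div_iff₀ (by positivity)]; nlinarith)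
      positivity
    refine (mean_fails_le hk0 (fun e => e.2.trans (hk e.1)) hp.le (fun e => hD e.1) (hs χ)
      (Δ := B) (by linarith) (fun e => ?_) (half_pos hε) (by linarith) (by linarith) hb0 hT).trans
      (ENNReal.ofReal_le_ofReal ?_)
    · have := hcp e.1
      have : (0 : ℝ) ≤ cm e.1 := Nat.cast_nonneg _
      linarith
    · rw [Fintype.card_fin]
      refine sparsified_failure_exponent_le hk0 hB hp hp1 hε hε1 ?_ hμ₀ hb
      push_cast
      refine hN'.trans ?_
      have hden : 0 < p * ε ^ 3 := by positivity
      rw [mul_div_assoc', le_div_iff₀ hden]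
      have hε2 : ε ^ 2 ≤ 1 := by nlinarith
      have hε3 : ε ^ 3 ≤ 1 := by nlinarith [sq_nonneg ε]
      have hpe : p * ε ^ 3 ≤ 1 := by nlinarith [pow_pos hε 3]
      have hk3 : (1 : ℝ) ≤ k ^ 3 := one_le_pow₀ hk1
      have hk23 : (k : ℝ) ^ 2 ≤ k ^ 3 := pow_le_pow_right₀ hk1 (by norm_num)
      have hBk : (1 : ℝ) ≤ B * k ^ 3 := by nlinarith
      have h2 : 2 * (p * ε ^ 3) ≤ 4 * μ₀ * (B * k ^ 3) := by nlinarith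
      have hexp : (8 * k ^ 2 * m / ε ^ 2 + 2) * (p * ε ^ 3)
          = 8 * k ^ 2 * (m * (p * ε)) + 2 * (p * ε ^ 3) := by field_simp
      rw [hexp]
      -- The constant `260` is `256` for this main term plus `4` for the additive `2` in `hN'`.
      suffices h : 8 * k ^ 2 * (m * (p * ε)) ≤ 256 * μ₀ * (B * k ^ 3) by linarith
      by_cases hl : Large
      · have hμ : p * m / (8 * k) ≤ μ₀ := by
          simp only [μ₀, if_pos hl]; exact le_max_right _ _
        rw [div_le_iff₀ (by positivity)] at hμ
        calc 8 * (k : ℝ) ^ 2 * (m * (p * ε)) = 8 * k ^ 2 * (p * m) * ε := by ring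
          _ ≤ 8 * k ^ 2 * (μ₀ * (8 * k)) * 1 := by gcongr
          _ = 64 * μ₀ * (1 * k ^ 3) := by ring
          _ ≤ 256 * μ₀ * (B * k ^ 3) := by gcongr; norm_num
      · have h1 : m < 16 * B / (p * ε) := not_le.1 hl
        rw [lt_div_iff₀ (by positivity)] at h1
        calc 8 * (k : ℝ) ^ 2 * (m * (p * ε)) ≤ 8 * k ^ 3 * (16 * B) := by gcongr
          _ = 256 * (1 / 2) * (B * k ^ 3) := by ring
          _ ≤ 256 * μ₀ * (B * k ^ 3) := by gcongr
  refine ofReal_one_sub_le_prob hε.le (hbound.trans ?_)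
  simp only [mean_add, mean_const]
  have h2 : (mean (PMF.uniformOfFintype (V → Fin (N + 1))) fun χ => mean (piPMF D) fun c => F₂ χ c)
      ≤ ENNReal.ofReal (ε / 4) := by
    -- The optimal matching `M c` depends on the weights only, and the colouring is independent of
    -- them.
    rw [mean_comm]
    exact mean_le_of_le hF₂
  have h3 := mean_le_of_le (P := PMF.uniformOfFintype (V → Fin (N + 1))) fun χ _ => hF₃ χ
  refine (add_le_add (add_le_add hF₁ h2) h3).trans_eq ?_
  rw [← ENNReal.ofReal_add (by linarith) (by linarith),
    ← ENNReal.ofReal_add (by linarith) (by linarith)]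
  congr 1; ring

end Sparsified

/-! ### Choice of the number of colours and of iterations. -/

theorem sparsification_parameters (B : ℕ) :
    ∃ C : ℝ, 0 < C ∧
      ∀ (V : Type*) [Fintype V] [DecidableEq V] (k : ℕ) (H : Finset (Finset V))
        (cm cp : H → ℕ) (p ε : ℝ),
        1 ≤ k → (∀ e ∈ H, e.card = k) → (∀ e, cm e ≤ cp e) → (∀ e, cp e ≤ B) →
        0 < p → p ≤ 1 → 0 < ε → ε < 1 →
        ∃ N T : ℕ,
          (T : ℝ) ≤ C * (k * (Real.log (k / (ε * p)) + 1 / ε) / (ε * p)) ∧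
          (∀ χ : V → Fin (N + 1), (∃ solve, IsSolver (colorInc (edgeSet H) χ) solve) ∧
            ∃ round, IsLPRelative (colorInc (edgeSet H) χ) (ratio k) round) ∧
          ∀ (D : H → PMF ℕ) (solve : ∀ χ : V → Fin (N + 1), Solver (Colorful (edgeSet H) χ))
            (round : ∀ χ : V → Fin (N + 1), Rounding (Colorful (edgeSet H) χ)),
            AdmissibleLaw cm cp p D →
            (∀ χ, IsSolver (colorInc (edgeSet H) χ) (solve χ)) →
            (∀ χ, IsLPRelative (colorInc (edgeSet H) χ) (ratio k) (round χ)) →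
            ENNReal.ofReal (1 - ε) ≤
              prob (sparsifiedStrategy (edgeSet H) cm cp N solve round T D)
                (goodRuns (edgeSet H) ((1 - ε) / ((k : ℝ) - 1 + 1 / (k : ℝ)))) ∧
            ∀ u : V,
              expectation (sparsifiedStrategy (edgeSet H) cm cp N solve round T D)
                  (queriesAt (edgeSet H) u) ≤
                ENNReal.ofReal
                  (C * (k * (Real.log (k / (ε * p)) + 1 / ε) / (ε * p))) := by
  -- Here `16640 = 4160 * 4`, the factor `4` coming from accuracy `ε / 2` in the survival bound.
  -- Using `B + 1` as the weight bound covers `B = 0`, and the final `+ 1` absorbs the ceiling in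
  -- `T`.
  refine ⟨16640 * ((B : ℝ) + 1) ^ 2 + 1, by positivity,
    fun V _ _ k H cm cp p ε hk0 hk _ hcp hp hp1 hε hε1 => ?_⟩
  have hk' : ∀ e : H, (edgeSet H e).card = k := fun e => hk e.1 e.2
  have hne : ∀ e : H, (edgeSet H e).Nonempty := fun e => Finset.card_pos.1 (by rw [hk']; omega)
  obtain ⟨x₀, hx₀⟩ := exists_lpOptimal hne cp
  have hk1 : (1 : ℝ) ≤ k := by exact_mod_cast hk0
  have hεp0 : 0 < ε * p := by positivity
  have hεp1 : ε * p ≤ 1 := by nlinarith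
  have hL : 0 ≤ Real.log (k / (ε * p)) := Real.log_nonneg (by rw [le_div_iff₀ hεp0]; linarith)
  have hinv : 1 ≤ 1 / ε := by rw [le_div_iff₀ hε]; linarith
  set X : ℝ := k * (Real.log (k / (ε * p)) + 1 / ε) with hX
  have hX1 : 1 ≤ X / (ε * p) := by
    rw [le_div_iff₀ hεp0]
    have : 1 * 1 ≤ X := mul_le_mul hk1 (by linarith) zero_le_one (by linarith)
    linarith
  set A : ℝ := (B : ℝ) + 1 with hA
  have hA1 : 1 ≤ A := by have : (0 : ℝ) ≤ B := Nat.cast_nonneg _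
                         linarith
  set b : ℝ := 4160 * A * X with hb
  set N := ⌈8 * k ^ 2 * lpValue cp x₀ / ε ^ 2⌉₊ with hN
  set T := ⌈b * (4 * A / (ε * p))⌉₊ with hT
  have hX0 : 0 ≤ X := by positivity
  have hval0 : 0 ≤ 8 * k ^ 2 * lpValue cp x₀ / ε ^ 2 := by
    have := hx₀.nonneg
    positivity
  have hTle : (T : ℝ) ≤ (16640 * A ^ 2 + 1) * (X / (ε * p)) := by
    refine (Nat.ceil_lt_add_one (by positivity)).le.trans ?_
    have : b * (4 * A / (ε * p)) = 16640 * A ^ 2 * (X / (ε * p)) := by rw [hb]; ring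
    rw [this]
    linarith
  refine ⟨N, T, hTle, fun χ => ⟨exists_isSolver fun e => (hne e.1).image χ,
    exists_isLPRelative hk0 fun e => e.2.trans (hk' e.1)⟩, fun D solve round hD hs hr => ⟨?_, ?_⟩⟩
  · refine sparsifiedStrategy_approx (b := b) hk0 hk' hA1 (fun e => ?_) hp hp1 hε hε1 hx₀ ?_ ?_ rfl
      ?_ hD hs hr
    · have : (cp e : ℝ) ≤ B := by exact_mod_cast hcp e
      linarith
    · exact (Nat.le_ceil _).trans (by linarith)
    · have := (Nat.ceil_lt_add_one hval0).le
      linarith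
    · have h1 : b * (4 * A / (ε * p)) ≤ T := Nat.le_ceil _
      have h2 := mul_le_mul_of_nonneg_right h1 (show 0 ≤ p * (ε / 2 / 2 / A) by positivity)
      refine le_trans (le_of_eq ?_) h2
      field_simp; norm_num
  · intro u
    refine (mean_queriesAt_le hne cm cp hs round T D u).trans ?_
    rw [← ENNReal.ofReal_natCast]
    exact ENNReal.ofReal_le_ofReal hTle

end StochMatching

open StochMatching in
theorem mainTheorem7 :
    -- the adaptive strategy
    (∃ C : ℝ, 0 < C ∧
      ∀ (V : Type*) [Fintype V] [DecidableEq V] (k : ℕ) (H : Finset (Finset V))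
        (cm cp : H → ℕ) (p ε : ℝ),
        1 ≤ k → (∀ e ∈ H, e.card = k) → (∀ e, cm e ≤ cp e) →
        0 < p → p ≤ 1 → 0 < ε → ε < 1 →
        (∃ solve, IsSolver (edgeSet H) solve) ∧
        (∃ round, IsLPRelative (edgeSet H) (ratio k) round) ∧
        ∀ (D : H → PMF ℕ) (solve : Solver H) (round : Rounding H) (T : ℕ),
          AdmissibleLaw cm cp p D → IsSolver (edgeSet H) solve →
          IsLPRelative (edgeSet H) (ratio k) round →
          C * ((maxGap cm cp : ℝ) * (k * Real.log (Fintype.card V / ε) + 1 / ε) / (ε * p)) ≤ T →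
          ENNReal.ofReal (1 - ε) ≤
            prob (adaptiveStrategy cm cp solve round T D)
              (goodRuns (edgeSet H) ((1 - ε) / ((k : ℝ) - 1 + 1 / (k : ℝ))))) ∧
    -- sparse dual optimal solutions and the sparse witness cover
    (∀ (V : Type*) [Fintype V] [DecidableEq V] (k : ℕ) (H : Finset (Finset V)),
      1 ≤ k → (∀ e ∈ H, e.card = k) →
      (∀ (c : H → ℕ) (μ : ℝ), (∃ x, LPOptimal (edgeSet H) c x ∧ lpValue c x < μ) →
        ∃ y, DualOptimal (edgeSet H) c y ∧ (suppCard y : ℝ) < k * μ) ∧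
      (∀ ε μ : ℝ, 0 < ε → ε < 1 → 1 ≤ μ →
        IsWitnessCover (edgeSet H) ε (ε / 2) μ (sparseCover V k ε μ))) ∧
    -- the variant with vertex sparsification
    (∀ B : ℕ, ∃ C : ℝ, 0 < C ∧
      ∀ (V : Type*) [Fintype V] [DecidableEq V] (k : ℕ) (H : Finset (Finset V))
        (cm cp : H → ℕ) (p ε : ℝ),
        1 ≤ k → (∀ e ∈ H, e.card = k) → (∀ e, cm e ≤ cp e) → (∀ e, cp e ≤ B) →
        0 < p → p ≤ 1 → 0 < ε → ε < 1 →
        ∃ N T : ℕ,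
          (T : ℝ) ≤ C * (k * (Real.log (k / (ε * p)) + 1 / ε) / (ε * p)) ∧
          (∀ χ : V → Fin (N + 1), (∃ solve, IsSolver (colorInc (edgeSet H) χ) solve) ∧
            ∃ round, IsLPRelative (colorInc (edgeSet H) χ) (ratio k) round) ∧
          ∀ (D : H → PMF ℕ) (solve : ∀ χ : V → Fin (N + 1), Solver (Colorful (edgeSet H) χ))
            (round : ∀ χ : V → Fin (N + 1), Rounding (Colorful (edgeSet H) χ)),
            AdmissibleLaw cm cp p D →
            (∀ χ, IsSolver (colorInc (edgeSet H) χ) (solve χ)) →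
            (∀ χ, IsLPRelative (colorInc (edgeSet H) χ) (ratio k) (round χ)) →
            ENNReal.ofReal (1 - ε) ≤
              prob (sparsifiedStrategy (edgeSet H) cm cp N solve round T D)
                (goodRuns (edgeSet H) ((1 - ε) / ((k : ℝ) - 1 + 1 / (k : ℝ)))) ∧
            ∀ u : V,
              expectation (sparsifiedStrategy (edgeSet H) cm cp N solve round T D)
                  (queriesAt (edgeSet H) u) ≤
                ENNReal.ofReal
                  (C * (k * (Real.log (k / (ε * p)) + 1 / ε) / (ε * p)))) := by
  refine ⟨⟨16, by norm_num, fun V _ _ k H cm cp p ε hk0 hk _ hp _ hε hε1 => ?_⟩,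
    fun V _ _ k H hk0 hk => ?_, fun B => sparsification_parameters B⟩
  · have hk' : ∀ e : H, (edgeSet H e).card = k := fun e => hk e.1 e.2
    exact ⟨exists_isSolver fun e => Finset.card_pos.1 (by rw [hk']; omega),
      exists_isLPRelative hk0 hk', fun D solve round T hD hs hr hT =>
        adaptiveStrategy_approx hk0 hk' hp hε hε1 hD hs hr hT⟩
  · have hk' : ∀ e : H, (edgeSet H e).card = k := fun e => hk e.1 e.2
    refine ⟨fun c μ hx => ?_, fun ε μ hε _ hμ => ?_⟩
    · obtain ⟨x, hx, hμ⟩ := hx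
      exact exists_dualOptimal_suppCard_lt hk0 hk' hx hμ
    · exact isWitnessCover_sparseCover hk0 hk' hε (zero_le_one.trans hμ)
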